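/- A spherical tiling by pentagons is a covering of the unit sphere $S^2$ by finitely many closed topological discs (the tiles) with pairwise disjoint interiors, the boundary circle of each tile being divided by five corners into five sides, such that: every side of a tile is also a side of exactly one other tile; two sides coincide or meet only at common end points; every vertex (the position of a corner) has degree at least $3$. The sides need not be great arcs; they are only required to have area zero and to be such that each tile has an interior angle at each of its corners, where a region $P$ has interior angle $\theta$ at $v$ if the proportion of the disc of radius $r$ around $v$ that is covered by $P$ tends to $\theta/2\pi$ as $r\to 0$. Two tiles are angle congruent if there is a bijection between their sides that preserves adjacency and the angles between adjacent sides. The anglewise vertex combination of a tiling is the collection, with multiplicities, of the angle combinations at all its vertices; for example $\{2\alpha^3, 6\beta^2\gamma,\dots\}$ means that at two vertices the angles are $\alpha,\alpha,\alpha$, at six vertices they are $\beta,\beta,\gamma$, and so on. Proposition 20. Let a spherical tiling consist of $12$ pairwise angle congruent pentagons, the five angles of each tile being five distinct numbers, one of which is $\alpha=\frac{2\pi}{3}$. Then the other four angles can be named $\beta,\gamma,\delta,\epsilon$ in such a way that the anglewise vertex combination of the tiling is $$\{2\alpha^3,\ 6\alpha\gamma\epsilon,\ 6\beta^2\gamma,\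 6\delta^2\epsilon\},$$ and that, up to the symmetries (rotations and reflections) of the dodecahedron, the tiling is combinatorially the dodecahedron with one of the following four assignments A, B, C, D of the angles. The faces of the dodecahedron are $P_1,\dots,P_{12}$, and the numbers of the neighbours of each face, in counterclockwise order, are: $P_{1}$: $2,3,4,5,6$; $P_{2}$: $1,6,11,7,3$; $P_{3}$: $1,2,7,8,4$; $P_{4}$: $1,3,8,9,5$; $P_{5}$: $1,4,9,10,6$; $P_{6}$: $1,5,10,11,2$; $P_{7}$: $2,11,12,8,3$; $P_{8}$: $3,7,12,9,4$; $P_{9}$: $4,8,12,10,5$; $P_{10}$: $5,9,12,11,6$; $P_{11}$: $6,10,12,7,2$; $P_{12}$: $11,10,9,8,7$. Below, the five angles of each face are listed in counterclockwise order, beginning with the corner between the sides shared with the last and the first neighbour in the list above (for $P_1$: the corner where $P_1,P_6,P_2$ meet, then the one where $P_1,P_2,P_3$ meet, and so on). Assignment A: $P_{1}$: $\gamma\alpha\beta\epsilon\delta$; $P_{2}$: $\gamma\alpha\beta\epsilon\delta$; $P_{3}$: $\beta\epsilon\delta\gamma\alpha$; $P_{4}$: $\delta\gamma\alpha\beta\epsilon$;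 $P_{5}$: $\epsilon\delta\gamma\alpha\beta$; $P_{6}$: $\epsilon\delta\gamma\alpha\beta$; $P_{7}$: $\epsilon\delta\gamma\alpha\beta$; $P_{8}$: $\alpha\beta\epsilon\delta\gamma$; $P_{9}$: $\alpha\beta\epsilon\delta\gamma$; $P_{10}$: $\beta\epsilon\delta\gamma\alpha$; $P_{11}$: $\gamma\alpha\beta\epsilon\delta$; $P_{12}$: $\alpha\beta\epsilon\delta\gamma$. Assignment B: $P_{1}$: $\gamma\alpha\beta\delta\epsilon$; $P_{2}$: $\gamma\alpha\beta\delta\epsilon$; $P_{3}$: $\gamma\epsilon\delta\beta\alpha$; $P_{4}$: $\delta\beta\alpha\gamma\epsilon$; $P_{5}$: $\delta\epsilon\gamma\alpha\beta$; $P_{6}$: $\epsilon\delta\beta\alpha\gamma$; $P_{7}$: $\delta\epsilon\gamma\alpha\beta$; $P_{8}$: $\alpha\gamma\epsilon\delta\beta$; $P_{9}$: $\alpha\beta\delta\epsilon\gamma$; $P_{10}$: $\gamma\epsilon\delta\beta\alpha$; $P_{11}$: $\beta\alpha\gamma\epsilon\delta$; $P_{12}$: $\alpha\beta\delta\epsilon\gamma$.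 Assignment C: $P_{1}$: $\epsilon\alpha\gamma\beta\delta$; $P_{2}$: $\epsilon\delta\beta\gamma\alpha$; $P_{3}$: $\beta\gamma\alpha\epsilon\delta$; $P_{4}$: $\gamma\beta\delta\epsilon\alpha$; $P_{5}$: $\delta\beta\gamma\alpha\epsilon$; $P_{6}$: $\delta\epsilon\alpha\gamma\beta$; $P_{7}$: $\alpha\epsilon\delta\beta\gamma$; $P_{8}$: $\epsilon\alpha\gamma\beta\delta$; $P_{9}$: $\epsilon\delta\beta\gamma\alpha$; $P_{10}$: $\gamma\alpha\epsilon\delta\beta$; $P_{11}$: $\gamma\beta\delta\epsilon\alpha$; $P_{12}$: $\delta\epsilon\alpha\gamma\beta$. Assignment D: $P_{1}$: $\gamma\alpha\epsilon\beta\delta$; $P_{2}$: $\epsilon\beta\delta\gamma\alpha$; $P_{3}$: $\delta\gamma\alpha\epsilon\beta$; $P_{4}$: $\gamma\delta\beta\epsilon\alpha$; $P_{5}$: $\delta\beta\epsilon\alpha\gamma$; $P_{6}$: $\beta\epsilon\alpha\gamma\delta$; $P_{7}$: $\alpha\epsilon\beta\delta\gamma$; $P_{8}$: $\gamma\alpha\epsilon\beta\delta$;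 $P_{9}$: $\gamma\delta\beta\epsilon\alpha$; $P_{10}$: $\epsilon\alpha\gamma\delta\beta$; $P_{11}$: $\epsilon\beta\delta\gamma\alpha$; $P_{12}$: $\beta\epsilon\alpha\gamma\delta$. -/

import Mathlib

open MeasureTheory Filter Topology

noncomputable section

namespace SphTiling

/-! ### The sphere, its area, and interior angles -/

/-- The unit sphere in Euclidean `3`-space. -/
abbrev S2 : Type := Metric.sphere (0 : EuclideanSpace ℝ (Fin 3)) 1

/-- The surface area measure of the unit sphere. -/
def area : Measure S2 := (volume : Measure (EuclideanSpace ℝ (Fin 3))).toSphere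

/-- The region `P` of the sphere has interior angle `θ` at the point `v`: the fraction of a small
disc around `v` that is covered by `P` tends to `θ / 2π`. If near `v` the region is bounded by two
curves with one-sided tangents at `v`, this is the angle from one tangent to the other, measured
through `P`. No curve has to be a great arc. -/
def HasInteriorAngle (P : Set S2) (v : S2) (θ : ℝ) : Prop :=
  Tendsto (fun r : ℝ =>
      2 * Real.pi * (area.real (P ∩ Metric.ball v r) / area.real (Metric.ball v r)))
    (𝓝[>] 0) (𝓝 θ)

/-! ### The model pentagon: the closed unit disc with five marked points on its boundary -/

/-- The point of the unit circle at parameter `s` of the `k`-th of the five boundary arcs. -/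
def boundaryPoint (k : Fin 5) (s : ℝ) : ℂ :=
  Complex.exp (2 * Real.pi * Complex.I * (((k : ℕ) : ℂ) + (s : ℂ)) / 5)

/-- The `k`-th boundary arc, from the `k`-th marked point to the `(k+1)`-st. -/
def boundaryArc (k : Fin 5) : Set ℂ := boundaryPoint k '' Set.Icc (0 : ℝ) 1

/-! ### Tilings of the sphere by pentagons -/

/-- An edge-to-edge tiling of the sphere by (curvilinear) pentagons, all of whose vertices have
degree at least `3`. The tiles are indexed by `ι`, and the corners and the sides of each tile by
`Fin 5`, cyclically: side `k` joins corner `k` to corner `k + 1`.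

Every tile is a closed topological disc (no boundary points are identified) whose boundary circle
is divided into five sides. The sides are arbitrary arcs of area zero such that the tiles have an
interior angle at each of their corners. -/
structure PentagonTiling (ι : Type*) [Fintype ι] where
  /-- A parametrization of each tile by the closed unit disc. -/
  chart : ι → ℂ → S2
  chart_continuousOn : ∀ i, ContinuousOn (chart i) (Metric.closedBall 0 1)
  chart_injOn : ∀ i, Set.InjOn (chart i) (Metric.closedBall 0 1)
  /-- The tiles cover the sphere. -/
  cover : (⋃ i, chart i '' Metric.closedBall 0 1) = Set.univ
  /-- The interior of a tile meets no other tile. -/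
  interior_disjoint : ∀ i j, i ≠ j →
    Disjoint (chart i '' Metric.ball 0 1) (chart j '' Metric.closedBall 0 1)
  /-- Every side of a tile is also a side of exactly one other tile. -/
  side_shared : ∀ i k, ∃! q : ι × Fin 5,
    q.1 ≠ i ∧ chart q.1 '' boundaryArc q.2 = chart i '' boundaryArc k
  /-- Two sides coincide, or meet at most at points that are end points of both. -/
  side_inter : ∀ i k j l,
    chart i '' boundaryArc k = chart j '' boundaryArc l ∨
    chart i '' boundaryArc k ∩ chart j '' boundaryArc l ⊆
      {chart i (boundaryPoint k 0), chart i (boundaryPoint (k + 1) 0)} ∩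
      {chart j (boundaryPoint l 0), chart j (boundaryPoint (l + 1) 0)}
  /-- The corners of all tiles are listed in the same sense (say counterclockwise, seen from outside
  the sphere), so that the two tiles at a common side run through it in opposite directions. This
  only fixes how the corners of a tile are numbered. -/
  counterclockwise : ∀ i k j l, i ≠ j →
    chart i '' boundaryArc k = chart j '' boundaryArc l →
    chart i (boundaryPoint k 0) = chart j (boundaryPoint (l + 1) 0) ∧
    chart i (boundaryPoint (k + 1) 0) = chart j (boundaryPoint l 0)
  /-- The number of corners at a vertex, which is the number of edges at it, is at least `3`. -/
  three_le_degree : ∀ i k,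
    3 ≤ Nat.card {q : ι × Fin 5 //
      chart q.1 (boundaryPoint q.2 0) = chart i (boundaryPoint k 0)}
  /-- The sides have area zero. -/
  side_null : ∀ i k, area (chart i '' boundaryArc k) = 0
  /-- The angle of the tile `i` at its corner `k`. -/
  angle : ι → Fin 5 → ℝ
  hasInteriorAngle : ∀ i k, HasInteriorAngle (chart i '' Metric.closedBall 0 1)
    (chart i (boundaryPoint k 0)) (angle i k)

namespace PentagonTiling

variable {ι : Type*} [Fintype ι] (T : PentagonTiling ι)

/-- The vertex of the tiling at the `k`-th corner of the tile `i`. -/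
def corner (i : ι) (k : Fin 5) : S2 := T.chart i (boundaryPoint k 0)

/-- The sides `k` and `l` of the tile `i` are adjacent, and the angle between them is `θ`. -/
def SidesMeet (i : ι) (k l : Fin 5) (θ : ℝ) : Prop :=
  (l = k + 1 ∧ θ = T.angle i l) ∨ (k = l + 1 ∧ θ = T.angle i k)

/-- Two tiles are angle congruent: there is a correspondence between their sides that preserves
adjacency and the angles between adjacent sides. -/
def AngleCongruent (i j : ι) : Prop :=
  ∃ f : Fin 5 ≃ Fin 5, ∀ k l θ, T.SidesMeet i k l θ ↔ T.SidesMeet j (f k) (f l) θ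

/-- The five angles of a tile, with multiplicity. -/
def tileAngles (i : ι) : Multiset ℝ := (Finset.univ : Finset (Fin 5)).val.map (T.angle i)

open Classical in
/-- The vertices of the tiling. -/
def vertices : Finset S2 :=
  (Finset.univ : Finset (ι × Fin 5)).image fun q => T.corner q.1 q.2

open Classical in
/-- The angles at a point of the sphere, with multiplicity. -/
def vertexAngles (v : S2) : Multiset ℝ :=
  ((Finset.univ : Finset (ι × Fin 5)).filter fun q => T.corner q.1 q.2 = v).val.map
    fun q => T.angle q.1 q.2

/-- The anglewise vertex combination: the collection, with multiplicity, of the angle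
combinations at all the vertices. -/
def anglewiseVertexCombination : Multiset (Multiset ℝ) :=
  T.vertices.val.map T.vertexAngles

end PentagonTiling

/-! ### The dodecahedron and the four angle assignments -/

/-- The faces of the dodecahedron are numbered from `0` to `11`, and `dodecNeighbour i k` is the
face across the `k`-th side of the face `i`, in counterclockwise order. -/
def dodecNeighbour : Fin 12 → Fin 5 → Fin 12 :=
  ![![1, 2, 3, 4, 5],
    ![0, 5, 10, 6, 2],
    ![0, 1, 6, 7, 3],
    ![0, 2, 7, 8, 4],
    ![0, 3, 8, 9, 5],
    ![0, 4, 9, 10, 1],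
    ![1, 10, 11, 7, 2],
    ![2, 6, 11, 8, 3],
    ![3, 7, 11, 9, 4],
    ![4, 8, 11, 10, 5],
    ![5, 9, 11, 6, 1],
    ![10, 9, 8, 7, 6]]

/-- The vertex at the `k`-th corner of the face `i`, named by the three faces around it. The `k`-th
corner lies between the sides `k - 1` and `k`. -/
def dodecVertex (i : Fin 12) (k : Fin 5) : Finset (Fin 12) :=
  {i, dodecNeighbour i (k - 1), dodecNeighbour i k}

/-- Names for five angles. -/
inductive AngleName : Type
  | α | β | γ | δ | ε
  deriving DecidableEq

instance : Fintype AngleName where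
  elems := {.α, .β, .γ, .δ, .ε}
  complete x := by cases x <;> decide

/-- The four assignments of angles to the corners of the dodecahedron: `pattern n i k` is the angle
of the face `i` at its `k`-th corner. -/
def pattern : Fin 4 → Fin 12 → Fin 5 → AngleName :=
  ![![![.γ, .α, .β, .ε, .δ],
      ![.γ, .α, .β, .ε, .δ],
      ![.β, .ε, .δ, .γ, .α],
      ![.δ, .γ, .α, .β, .ε],
      ![.ε, .δ, .γ, .α, .β],
      ![.ε, .δ, .γ, .α, .β],
      ![.ε, .δ, .γ, .α, .β],
      ![.α, .β, .ε, .δ, .γ],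
      ![.α, .β, .ε, .δ, .γ],
      ![.β, .ε, .δ, .γ, .α],
      ![.γ, .α, .β, .ε, .δ],
      ![.α, .β, .ε, .δ, .γ]],
    ![![.γ, .α, .β, .δ, .ε],
      ![.γ, .α, .β, .δ, .ε],
      ![.γ, .ε, .δ, .β, .α],
      ![.δ, .β, .α, .γ, .ε],
      ![.δ, .ε, .γ, .α, .β],
      ![.ε, .δ, .β, .α, .γ],
      ![.δ, .ε, .γ, .α, .β],
      ![.α, .γ, .ε, .δ, .β],
      ![.α, .β, .δ, .ε, .γ],
      ![.γ, .ε, .δ, .β, .α],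
      ![.β, .α, .γ, .ε, .δ],
      ![.α, .β, .δ, .ε, .γ]],
    ![![.ε, .α, .γ, .β, .δ],
      ![.ε, .δ, .β, .γ, .α],
      ![.β, .γ, .α, .ε, .δ],
      ![.γ, .β, .δ, .ε, .α],
      ![.δ, .β, .γ, .α, .ε],
      ![.δ, .ε, .α, .γ, .β],
      ![.α, .ε, .δ, .β, .γ],
      ![.ε, .α, .γ, .β, .δ],
      ![.ε, .δ, .β, .γ, .α],
      ![.γ, .α, .ε, .δ, .β],
      ![.γ, .β, .δ, .ε, .α],
      ![.δ, .ε, .α, .γ, .β]],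
    ![![.γ, .α, .ε, .β, .δ],
      ![.ε, .β, .δ, .γ, .α],
      ![.δ, .γ, .α, .ε, .β],
      ![.γ, .δ, .β, .ε, .α],
      ![.δ, .β, .ε, .α, .γ],
      ![.β, .ε, .α, .γ, .δ],
      ![.α, .ε, .β, .δ, .γ],
      ![.γ, .α, .ε, .β, .δ],
      ![.γ, .δ, .β, .ε, .α],
      ![.ε, .α, .γ, .δ, .β],
      ![.ε, .β, .δ, .γ, .α],
      ![.β, .ε, .α, .γ, .δ]]]

/-- The tiling `T` is the dodecahedron with the angle `b (L i k)` at the `k`-th corner of each face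
`i`, up to the symmetries of the dodecahedron (rotations and reflections): there are a
correspondence `e` between tiles and faces, and for each tile a correspondence `g i` between corners
that preserves adjacency, such that corners at the same vertex correspond to corners at the same
vertex (and conversely), and the angles are as prescribed. -/
def PentagonTiling.IsGivenBy {ι : Type*} [Fintype ι] (T : PentagonTiling ι)
    (L : Fin 12 → Fin 5 → AngleName) (b : AngleName → ℝ) : Prop :=
  ∃ (e : ι ≃ Fin 12) (g : ι → (Fin 5 ≃ Fin 5)),
    (∀ i k, g i (k + 1) = g i k + 1 ∨ g i k = g i (k + 1) + 1) ∧
    (∀ i k j l, T.corner i k = T.corner j l ↔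
      dodecVertex (e i) (g i k) = dodecVertex (e j) (g j l)) ∧
    (∀ i k, T.angle i k = b (L (e i) (g i k)))

end SphTiling

end

/-!
The proof has a topological, a combinatorial and an arithmetical part.

*Topology.* A small disc around a vertex is covered, up to area zero, by the tiles with a corner
there, so the angles at every vertex add up to `2π` (`sum_angle_dartsAt`). Next, the tiling has at
least `20` vertices. In a spanning tree of the dual graph, the `12` tiles are connected across `11`
of the `30` sides, and the remaining `19` sides form a forest: together with a connection of its end
points by other remaining sides, a side would form a closed curve that does not separate the sphere
(`not_joinedIn_of_notMem`). This contradicts the separation half of the Jordan curve theorem, which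
is proved by gluing logarithms of `(z - q) / (z - p)` on the complements of two paths from `p` to `q`
(`not_isPreconnected_compl_range_union`). As there are `60` corners, every vertex has degree exactly
`3`.

*Combinatorics.* The dodecahedron can be laid out over the tiling face by face, starting anywhere.
This closes up at each vertex because all degrees are `3`, so the tiling is combinatorially the
dodecahedron (`exists_dodecahedral_labelling`).

*Angles.* Subtract `2π / 3` from all angles. The values then add up to `0` at every vertex, `α` gets
the value `0`, and each angle occurs `12` times. Counting signs shows that two values are positive
and two are negative, and that some vertices have the types `P, P, N` and `N', N', P'`. It follows
that the values of `α, β, γ, δ, ε` are proportional to `0, 1, -2, -1, 2`, up to names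
(`angle_classification`). All tiles carry the same cyclic word of angles up to rotation and
reflection, and an exhaustive search over its positions on the dodecahedron leaves only the four
patterns (`isSymmetricPattern_of_vertex_sums`), from which the vertex combination is read off.
-/

open MeasureTheory Filter Topology

noncomputable section

namespace SphTiling

/-! ### Separation of the plane by a closed curve -/

open unitInterval

/-- Off a path from `γ 0` to `γ 1` there is a continuous logarithm of `(z - γ 1) / (z - γ 0)`: lift
the homotopy `(t, z) ↦ (z - γ t) / (z - γ 0)`, which starts at the constant `1`, through the
covering `exp`. -/
lemma exists_log_off_path (γ : C(I, ℂ)) : ∃ L : ℂ → ℂ, ContinuousOn L (Set.range γ)ᶜ ∧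
    ∀ z ∈ (Set.range γ)ᶜ, Complex.exp (L z) = (z - γ 1) / (z - γ 0) := by
  have hne : ∀ (z : ((Set.range γ)ᶜ : Set ℂ)) (t : I), (z : ℂ) - γ t ≠ 0 := fun z t h =>
    z.2 ⟨t, (sub_eq_zero.1 h).symm⟩
  let H : C(I × ((Set.range γ)ᶜ : Set ℂ), {z : ℂ // z ≠ 0}) :=
    ⟨fun x => ⟨((x.2 : ℂ) - γ x.1) / ((x.2 : ℂ) - γ 0), div_ne_zero (hne _ _) (hne _ _)⟩, by
      refine Continuous.subtype_mk (Continuous.div (by fun_prop) (by fun_prop) fun x => hne _ _) _⟩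
  let L := Complex.isCoveringMap_exp.liftHomotopy H (ContinuousMap.const _ 0) (fun z => by
    ext
    simp [H, div_self (hne z 0)])
  have hL : ∀ x, Complex.exp (L x) = ((x.2 : ℂ) - γ x.1) / ((x.2 : ℂ) - γ 0) := fun x =>
    congrArg Subtype.val (congrFun (Complex.isCoveringMap_exp.liftHomotopy_lifts H
      (ContinuousMap.const _ 0) _) x)
  classical
  refine ⟨fun z => if h : z ∈ (Set.range γ)ᶜ then L (1, ⟨z, h⟩) else 0, ?_, ?_⟩
  · rw [continuousOn_iff_continuous_domRestrict]
    have : Continuous fun z : ((Set.range γ)ᶜ : Set ℂ) => L (1, z) := by fun_prop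
    convert this using 2 with z
    simp only [Set.domRestrict_apply]
    exact dif_pos z.2
  · intro z hz
    simp only [dif_pos hz]
    exact hL (1, ⟨z, hz⟩)

lemma eqOn_of_exp_eqOn {A : Type*} [TopologicalSpace A] {s : Set A} (hs : IsPreconnected s)
    {g h : A → ℂ} (hg : ContinuousOn g s) (hh : ContinuousOn h s)
    (he : ∀ x ∈ s, Complex.exp (g x) = Complex.exp (h x)) {a : A} (ha : a ∈ s) (hgh : g a = h a) :
    Set.EqOn g h s :=
  Complex.isCoveringMap_exp.eqOn_of_comp_eqOn hs hg hh
    (fun x hx => Subtype.ext (he x hx)) ha hgh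

lemma not_continuousOn_log_circle {p c : ℂ} {r : ℝ} (hr : 0 < r) (L : ℂ → ℂ)
    (hL : ContinuousOn L (Metric.sphere p r)) :
    ¬ ∀ z ∈ Metric.sphere p r, Complex.exp (L z) = c * (z - p) := by
  intro hexp
  let z : ℝ → ℂ := fun θ => p + r * Complex.exp (θ * Complex.I)
  have hz : ∀ θ, z θ ∈ Metric.sphere p r := fun θ => by
    simp [z, Complex.norm_exp_ofReal_mul_I, abs_of_pos hr]
  have hzc : Continuous z := by fun_prop
  have hcont : Continuous fun θ => L (z θ) := hL.comp_continuous hzc hz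
  have key := eqOn_of_exp_eqOn (s := Set.univ) isPreconnected_univ
    (g := fun θ : ℝ => L (z θ)) (h := fun θ : ℝ => L (z 0) + θ * Complex.I)
    hcont.continuousOn (by fun_prop) (fun θ _ => by
      rw [Complex.exp_add, hexp _ (hz _), hexp _ (hz _)]
      simp [z]
      ring) (Set.mem_univ 0) (by simp)
  have h1 := key (Set.mem_univ (2 * Real.pi))
  have h2 : z (2 * Real.pi) = z 0 := by simp [z]
  simp only [h2] at h1
  have h3 : ((2 * Real.pi : ℝ) : ℂ) * Complex.I = 0 := by
    linear_combination -h1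
  simp [Real.pi_ne_zero] at h3

/-- The separation half of the Jordan curve theorem, for a closed curve that consists of two paths
meeting only at their end points; the paths need not be injective. If the complement were
connected, the logarithms of `(z - q) / (z - p)` off the two paths would differ by a constant there,
so they would glue to a logarithm on the plane minus `p` and `q`. There is none on a small circle
around `p`. -/
theorem not_isPreconnected_compl_range_union {p q : ℂ} (hpq : p ≠ q) (γ₁ γ₂ : Path p q)
    (h : Set.range γ₁ ∩ Set.range γ₂ ⊆ {p, q}) :
    ¬ IsPreconnected (Set.range γ₁ ∪ Set.range γ₂)ᶜ := by
  intro hconn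
  obtain ⟨L₁, hc₁, he₁⟩ := exists_log_off_path γ₁.toContinuousMap
  obtain ⟨L₂, hc₂, he₂⟩ := exists_log_off_path γ₂.toContinuousMap
  have hU : IsOpen (Set.range γ₁)ᶜ := (isCompact_range γ₁.continuous).isClosed.isOpen_compl
  have hV : IsOpen (Set.range γ₂)ᶜ := (isCompact_range γ₂.continuous).isClosed.isOpen_compl
  simp only [Path.coe_toContinuousMap, γ₁.source, γ₁.target, γ₂.source, γ₂.target] at *
  rw [Set.compl_union] at hconn
  obtain ⟨c, hc, hcexp⟩ : ∃ c : ℂ, (∀ z ∈ (Set.range γ₁)ᶜ ∩ (Set.range γ₂)ᶜ, L₁ z = L₂ z + c) ∧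
      Complex.exp c = 1 := by
    rcases Set.eq_empty_or_nonempty ((Set.range γ₁)ᶜ ∩ (Set.range γ₂)ᶜ) with h0 | ⟨a, ha⟩
    · exact ⟨0, by simp [h0]⟩
    · have hexp : Complex.exp (L₁ a - L₂ a) = 1 := by
        rw [Complex.exp_sub, he₁ a ha.1, he₂ a ha.2, div_self]
        rw [← he₁ a ha.1]
        exact Complex.exp_ne_zero _
      refine ⟨L₁ a - L₂ a, ?_, hexp⟩
      refine eqOn_of_exp_eqOn hconn (hc₁.mono Set.inter_subset_left)
        ((hc₂.mono Set.inter_subset_right).add continuousOn_const) ?_ ha (by ring)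
      intro z hz
      rw [Complex.exp_add, hexp, he₁ z hz.1, he₂ z hz.2, mul_one]
  classical
  let L : ℂ → ℂ := fun z => if z ∈ (Set.range γ₁)ᶜ then L₁ z else L₂ z + c
  have hLV : ∀ z ∈ (Set.range γ₂)ᶜ, L z = L₂ z + c := by
    intro z hz
    by_cases hz1 : z ∈ (Set.range γ₁)ᶜ
    · simp only [L, if_pos hz1]; exact hc z ⟨hz1, hz⟩
    · simp only [L, if_neg hz1]
  have hcov : ∀ z, z ≠ p → z ≠ q → z ∈ (Set.range γ₁)ᶜ ∨ z ∈ (Set.range γ₂)ᶜ := by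
    intro z hzp hzq
    by_contra! hcon
    simp only [Set.mem_compl_iff, not_not] at hcon
    rcases h ⟨hcon.1, hcon.2⟩ with h | h
    · exact hzp h
    · exact hzq h
  have hLc : ∀ z, z ≠ p → z ≠ q → ContinuousAt L z := by
    intro z hzp hzq
    rcases hcov z hzp hzq with hz | hz
    · refine (hc₁.continuousAt (hU.mem_nhds hz)).congr ?_
      filter_upwards [hU.mem_nhds hz] with y hy
      exact (if_pos hy).symm
    · refine ((hc₂.continuousAt (hV.mem_nhds hz)).add (continuousAt_const (y := c))).congr ?_
      filter_upwards [hV.mem_nhds hz] with y hy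
      exact (hLV y hy).symm
  have hLe : ∀ z, z ≠ p → z ≠ q → Complex.exp (L z) = (z - q) / (z - p) := by
    intro z hzp hzq
    rcases hcov z hzp hzq with hz | hz
    · simp only [L, if_pos hz]; exact he₁ z hz
    · rw [hLV z hz, Complex.exp_add, hcexp, mul_one]; exact he₂ z hz
  have hd : 0 < ‖p - q‖ := norm_pos_iff.2 (sub_ne_zero.2 hpq)
  have hpq' : p - q ≠ 0 := sub_ne_zero.2 hpq
  have hsp : ∀ z ∈ Metric.sphere p (‖p - q‖ / 2), z ≠ p ∧ z ≠ q ∧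
      (z - q) / (p - q) ∈ Complex.slitPlane := by
    intro z hz
    rw [mem_sphere_iff_norm] at hz
    refine ⟨?_, ?_, ?_⟩
    · rintro rfl; rw [sub_self, norm_zero] at hz; linarith
    · rintro rfl; rw [norm_sub_rev] at hz; linarith
    · have : (z - q) / (p - q) = 1 + (z - p) / (p - q) := by field_simp; ring
      rw [this]
      apply Complex.mem_slitPlane_of_norm_lt_one
      rw [norm_div, hz, div_lt_one hd]
      linarith
  -- On the circle the factor `(z - q) / (p - q)` is close to `1` and has its principal logarithm.
  refine not_continuousOn_log_circle (p := p) (c := (p - q)⁻¹) (half_pos hd)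
    (fun z => Complex.log ((z - q) / (p - q)) - L z) ?_ ?_
  · refine ContinuousOn.sub ?_ fun z hz => (hLc z (hsp z hz).1 (hsp z hz).2.1).continuousWithinAt
    exact ContinuousOn.clog (by fun_prop) fun z hz => (hsp z hz).2.2
  · intro z hz
    obtain ⟨h1, h2, h3⟩ := hsp z hz
    have h1' := sub_ne_zero.2 h1
    have h2' := sub_ne_zero.2 h2
    rw [Complex.exp_sub, Complex.exp_log (Complex.slitPlane_ne_zero h3), hLe z h1 h2]
    field_simp

/-! ### Closed curves and finite sets on the sphere -/

/-- Stereographic projection from `n`, with values in `ℂ`. -/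
lemma exists_plane_chart (n : S2) :
    ∃ f : OpenPartialHomeomorph S2 ℂ, f.source = {n}ᶜ ∧ f.target = Set.univ := by
  have : Fact (Module.finrank ℝ (EuclideanSpace ℝ (Fin 3)) = 2 + 1) := ⟨by simp⟩
  refine ⟨(stereographic' 2 n).trans
    (Complex.orthonormalBasisOneI.repr.symm.toHomeomorph.toOpenPartialHomeomorph), ?_, ?_⟩
  · simp
  · simp

theorem not_isPreconnected_compl_of_paths {n p q : S2} (hpq : p ≠ q) (γ₁ γ₂ : Path p q)
    (hn₁ : n ∉ Set.range γ₁) (hn₂ : n ∉ Set.range γ₂)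
    (h : Set.range γ₁ ∩ Set.range γ₂ ⊆ {p, q}) :
    ¬ IsPreconnected (Set.range γ₁ ∪ Set.range γ₂ ∪ {n})ᶜ := by
  intro hconn
  obtain ⟨f, hs, ht⟩ := exists_plane_chart n
  have hcont : ContinuousOn f {n}ᶜ := hs ▸ f.continuousOn
  have hinj : Set.InjOn f {n}ᶜ := hs ▸ f.injOn
  have hsub₁ : Set.range γ₁ ⊆ {n}ᶜ := fun x hx hxn => hn₁ (by rw [← show x = n from hxn]; exact hx)
  have hsub₂ : Set.range γ₂ ⊆ {n}ᶜ := fun x hx hxn => hn₂ (by rw [← show x = n from hxn]; exact hx)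
  have hp : p ∈ ({n}ᶜ : Set S2) := hsub₁ ⟨0, γ₁.source⟩
  have hq : q ∈ ({n}ᶜ : Set S2) := hsub₁ ⟨1, γ₁.target⟩
  refine not_isPreconnected_compl_range_union (p := f p) (q := f q)
    (fun he => hpq (hinj hp hq he)) (γ₁.map' (hcont.mono hsub₁)) (γ₂.map' (hcont.mono hsub₂)) ?_ ?_
  · rintro z ⟨⟨s, hs'⟩, ⟨t, ht'⟩⟩
    change f (γ₁ s) = z at hs'
    change f (γ₂ t) = z at ht'
    have hst : γ₁ s = γ₂ t := hinj (hsub₁ ⟨s, rfl⟩) (hsub₂ ⟨t, rfl⟩) (hs'.trans ht'.symm)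
    rcases h ⟨⟨s, rfl⟩, ⟨t, hst.symm⟩⟩ with h | h
    · left; rw [← hs', h]
    · right; rw [← hs', h]; rfl
  · convert hconn.image f (hcont.mono fun x hx hxn => hx (Or.inr hxn)) using 1
    ext z
    obtain ⟨x, hx, rfl⟩ : ∃ x ∈ ({n}ᶜ : Set S2), f x = z :=
      ⟨f.symm z, hs ▸ f.map_target (by simp [ht]), f.right_inv (by simp [ht])⟩
    constructor
    · intro hz
      refine ⟨x, ?_, rfl⟩
      rintro ((⟨t, rfl⟩ | ⟨t, rfl⟩) | h)
      · exact hz (Or.inl ⟨t, rfl⟩)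
      · exact hz (Or.inr ⟨t, rfl⟩)
      · exact hx h
    · rintro ⟨y, hy, hyx⟩ hz
      have : y = x := hinj (fun h => hy (Or.inr h)) hx hyx
      subst this
      rcases hz with ⟨t, ht⟩ | ⟨t, ht⟩
      · exact hy (Or.inl (Or.inl ⟨t, hinj (hsub₁ ⟨t, rfl⟩) hx ht⟩))
      · exact hy (Or.inl (Or.inr ⟨t, hinj (hsub₂ ⟨t, rfl⟩) hx ht⟩))

lemma isPreconnected_compl_of_finite {s : Set S2} (hfin : s.Finite) {n : S2} (hn : n ∈ s) :
    IsPreconnected sᶜ := by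
  obtain ⟨f, hs, ht⟩ := exists_plane_chart n
  have hc : IsPreconnected (f '' (s \ {n}))ᶜ := by
    refine ((hfin.sdiff.image f).countable.isConnected_compl_of_one_lt_rank ?_).isPreconnected
    simp
  have hcont : ContinuousOn f.symm Set.univ := ht ▸ f.continuousOn_symm
  convert hc.image f.symm (hcont.mono (Set.subset_univ _)) using 1
  ext x
  constructor
  · intro hx
    have hxs : x ∈ f.source := by rw [hs]; rintro rfl; exact hx hn
    refine ⟨f x, ?_, f.left_inv hxs⟩
    rintro ⟨y, hy, hyx⟩
    exact hx (f.injOn (by rw [hs]; exact hy.2) hxs hyx ▸ hy.1)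
  · rintro ⟨z, hz, rfl⟩ hx
    have hz' : z ∈ f.target := by simp [ht]
    have hsrc : f.symm z ∈ f.source := f.map_target hz'
    rw [hs] at hsrc
    exact hz ⟨f.symm z, ⟨hx, hsrc⟩, f.right_inv hz'⟩

/-! ### Tiles, sides and corners -/

lemma boundaryPoint_eq (k : Fin 5) (s : ℝ) : boundaryPoint k s =
    Complex.exp ((2 * Real.pi * (((k : ℕ) + s) / 5) : ℝ) * Complex.I) := by
  unfold boundaryPoint
  congr 1
  push_cast
  ring

lemma norm_boundaryPoint (k : Fin 5) (s : ℝ) : ‖boundaryPoint k s‖ = 1 := by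
  rw [boundaryPoint_eq, Complex.norm_exp_ofReal_mul_I]

lemma continuous_boundaryPoint (k : Fin 5) : Continuous (boundaryPoint k) := by
  unfold boundaryPoint; fun_prop

lemma boundaryPoint_one (k : Fin 5) : boundaryPoint k 1 = boundaryPoint (k + 1) 0 := by
  by_cases hk : k = 4
  · subst hk
    have : ((4 : Fin 5) + 1) = 0 := rfl
    rw [this, boundaryPoint_eq, boundaryPoint_eq, Complex.exp_eq_exp_iff_exists_int]
    refine ⟨1, ?_⟩
    simp
    ring
  · have h : ((k + 1 : Fin 5) : ℕ) = k + 1 := by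
      revert k; decide
    rw [boundaryPoint_eq, boundaryPoint_eq, h]
    push_cast
    simp

lemma boundaryPoint_inj {k l : Fin 5} {s t : ℝ} (hs : s ∈ Set.Ico (0 : ℝ) 1)
    (ht : t ∈ Set.Ico (0 : ℝ) 1) (h : boundaryPoint k s = boundaryPoint l t) : k = l ∧ s = t := by
  rw [boundaryPoint_eq, boundaryPoint_eq, Complex.exp_eq_exp_iff_exists_int] at h
  obtain ⟨n, hn⟩ := h
  have h1 : (((2 * Real.pi * (((k : ℕ) + s) / 5) : ℝ) : ℂ)) =
      ((2 * Real.pi * (((l : ℕ) + t) / 5) : ℝ) : ℂ) + n * (2 * Real.pi) := by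
    apply mul_right_cancel₀ Complex.I_ne_zero
    rw [hn]; ring
  have h2 : 2 * Real.pi * (((k : ℕ) + s) / 5) = 2 * Real.pi * (((l : ℕ) + t) / 5) +
      n * (2 * Real.pi) := by exact_mod_cast h1
  have h3 : ((k : ℕ) : ℝ) + s = (l : ℕ) + t + 5 * n := by
    have hpi := Real.pi_pos
    apply mul_left_cancel₀ hpi.ne'
    linear_combination (5 / 2) * h2
  have hfl : ((k : ℕ) : ℤ) = (l : ℕ) + 5 * n := by
    have e1 : (((k : ℕ) : ℤ) - (l : ℕ) - 5 * n : ℤ) < 1 := by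
      have : ((((k : ℕ) : ℤ) - (l : ℕ) - 5 * n : ℤ) : ℝ) < 1 := by
        push_cast; linarith [hs.1, ht.2]
      exact_mod_cast this
    have e2 : -1 < (((k : ℕ) : ℤ) - (l : ℕ) - 5 * n : ℤ) := by
      have : (-1 : ℝ) < ((((k : ℕ) : ℤ) - (l : ℕ) - 5 * n : ℤ) : ℝ) := by
        push_cast; linarith [hs.2, ht.1]
      exact_mod_cast this
    omega
  have hkl : k = l := by
    ext
    have := k.2
    have := l.2
    omega
  subst hkl
  have hn0 : n = 0 := by omega
  subst hn0
  refine ⟨rfl, ?_⟩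
  push_cast at h3
  linarith

lemma exists_boundaryPoint_of_norm_eq_one {z : ℂ} (hz : ‖z‖ = 1) :
    ∃ (k : Fin 5) (s : ℝ), s ∈ Set.Ico (0 : ℝ) 1 ∧ boundaryPoint k s = z := by
  obtain ⟨θ, hθ⟩ := (Complex.norm_eq_one_iff z).1 hz
  let u : ℝ := Int.fract (θ / (2 * Real.pi))
  have hu0 : 0 ≤ u := Int.fract_nonneg _
  have hu1 : u < 1 := Int.fract_lt_one _
  have hfl : ⌊5 * u⌋₊ < 5 := by
    rw [Nat.floor_lt (by positivity)]
    push_cast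
    linarith
  refine ⟨⟨⌊5 * u⌋₊, hfl⟩, 5 * u - ⌊5 * u⌋₊, ⟨?_, ?_⟩, ?_⟩
  · linarith [Nat.floor_le (show 0 ≤ 5 * u by positivity)]
  · linarith [Nat.lt_floor_add_one (5 * u)]
  · rw [boundaryPoint_eq, ← hθ, Complex.exp_eq_exp_iff_exists_int]
    refine ⟨-⌊θ / (2 * Real.pi)⌋, ?_⟩
    have h : θ = 2 * Real.pi * (u + ⌊θ / (2 * Real.pi)⌋) := by
      have hf := Int.fract_add_floor (θ / (2 * Real.pi))
      change u + _ = _ at hf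
      rw [hf]
      field_simp
    have hc : (θ : ℂ) = 2 * Real.pi * (u + ⌊θ / (2 * Real.pi)⌋) := by exact_mod_cast h
    push_cast
    rw [hc]
    ring

lemma boundaryArc_subset_sphere (k : Fin 5) : boundaryArc k ⊆ Metric.sphere 0 1 := by
  rintro _ ⟨s, -, rfl⟩
  simp [norm_boundaryPoint]

lemma mid_notMem_boundaryArc {k l : Fin 5} (h : boundaryPoint k (1 / 2) ∈ boundaryArc l) :
    k = l := by
  obtain ⟨s, hs, he⟩ := h
  rcases eq_or_lt_of_le hs.2 with rfl | h1
  · rw [boundaryPoint_one] at he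
    have := (boundaryPoint_inj (by norm_num) (by norm_num) he).2
    norm_num at this
  · exact (boundaryPoint_inj ⟨hs.1, h1⟩ (by norm_num) he).1.symm

lemma boundaryArc_injective : Function.Injective boundaryArc := fun k _ h =>
  mid_notMem_boundaryArc (h ▸ ⟨1 / 2, by norm_num, rfl⟩ : boundaryPoint k (1 / 2) ∈ _)

namespace PentagonTiling

variable {ι : Type*} [Fintype ι] (T : PentagonTiling ι)

/-- The closed tile `i`. -/
def tile (i : ι) : Set S2 := T.chart i '' Metric.closedBall 0 1

/-- The tile `i` without its boundary circle. No use is made of its being open in the sphere. -/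
def openTile (i : ι) : Set S2 := T.chart i '' Metric.ball 0 1

/-- A pair `(i, k)` is called a dart. It stands for the side `k` of the tile `i`, run through
counterclockwise, and also for the corner `k` of `i`, where that side starts. -/
def side (d : ι × Fin 5) : Set S2 := T.chart d.1 '' boundaryArc d.2

/-- The vertex at which a dart starts. -/
def vtx (d : ι × Fin 5) : S2 := T.corner d.1 d.2

/-- The next dart around the same tile. -/
def next (d : ι × Fin 5) : ι × Fin 5 := (d.1, d.2 + 1)

lemma boundaryArc_subset_closedBall (k : Fin 5) : boundaryArc k ⊆ Metric.closedBall 0 1 :=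
  (boundaryArc_subset_sphere k).trans Metric.sphere_subset_closedBall

lemma boundaryPoint_mem_closedBall (k : Fin 5) (s : ℝ) :
    boundaryPoint k s ∈ Metric.closedBall (0 : ℂ) 1 := by
  simp [norm_boundaryPoint]

lemma isCompact_tile (i : ι) : IsCompact (T.tile i) :=
  (isCompact_closedBall 0 1).image_of_continuousOn (T.chart_continuousOn i)

lemma isClosed_tile (i : ι) : IsClosed (T.tile i) := (T.isCompact_tile i).isClosed

lemma side_subset_tile (d : ι × Fin 5) : T.side d ⊆ T.tile d.1 :=
  Set.image_mono (boundaryArc_subset_closedBall d.2)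

lemma openTile_subset_tile (i : ι) : T.openTile i ⊆ T.tile i :=
  Set.image_mono Metric.ball_subset_closedBall

lemma vtx_mem_tile (d : ι × Fin 5) : T.vtx d ∈ T.tile d.1 :=
  ⟨_, boundaryPoint_mem_closedBall _ _, rfl⟩

lemma vtx_mem_side (d : ι × Fin 5) : T.vtx d ∈ T.side d :=
  ⟨_, ⟨0, by norm_num, rfl⟩, rfl⟩

lemma corner_injective (i : ι) : Function.Injective (T.corner i) := fun k l h =>
  (boundaryPoint_inj (by norm_num) (by norm_num)
    (T.chart_injOn i (boundaryPoint_mem_closedBall _ _) (boundaryPoint_mem_closedBall _ _) h)).1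

lemma eq_of_vtx_eq {d d' : ι × Fin 5} (h : T.vtx d = T.vtx d') (h1 : d.1 = d'.1) : d = d' := by
  obtain ⟨i, k⟩ := d
  obtain ⟨j, l⟩ := d'
  obtain rfl : i = j := h1
  exact Prod.ext rfl (T.corner_injective i h)

lemma vtx_next_ne (d : ι × Fin 5) : T.vtx d ≠ T.vtx (next d) := by
  intro h
  have := congrArg Prod.snd (T.eq_of_vtx_eq h rfl)
  simp [next] at this

lemma tile_eq (i : ι) : T.tile i = T.openTile i ∪ ⋃ k, T.side (i, k) := by
  apply Set.Subset.antisymm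
  · rintro _ ⟨z, hz, rfl⟩
    rcases lt_or_eq_of_le (mem_closedBall_zero_iff.1 hz) with h | h
    · exact Or.inl ⟨z, by simpa using h, rfl⟩
    · obtain ⟨k, s, hs, rfl⟩ := exists_boundaryPoint_of_norm_eq_one h
      exact Or.inr (Set.mem_iUnion.2 ⟨k, _, ⟨s, ⟨hs.1, hs.2.le⟩, rfl⟩, rfl⟩)
  · exact Set.union_subset (T.openTile_subset_tile i)
      (Set.iUnion_subset fun k => T.side_subset_tile (i, k))

lemma disjoint_openTile_side (i : ι) (d : ι × Fin 5) : Disjoint (T.openTile i) (T.side d) := by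
  by_cases h : i = d.1
  · subst h
    rw [Set.disjoint_left]
    rintro _ ⟨z, hz, rfl⟩ ⟨w, hw, he⟩
    have := T.chart_injOn d.1 (boundaryArc_subset_closedBall _ hw)
      (Metric.ball_subset_closedBall hz) he
    subst this
    have h1 := boundaryArc_subset_sphere _ hw
    simp at hz h1
    linarith
  · exact (T.interior_disjoint i d.1 h).mono_right (T.side_subset_tile d)

lemma mem_side_of_mem_tiles {i j : ι} (hij : i ≠ j) {x : S2} (hi : x ∈ T.tile i)
    (hj : x ∈ T.tile j) : ∃ k, x ∈ T.side (i, k) := by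
  rw [tile_eq] at hi
  rcases hi with hi | hi
  · exact absurd hj (Set.disjoint_left.1 (T.interior_disjoint i j hij) hi)
  · exact Set.mem_iUnion.1 hi

/-! ### Darts -/

lemma exists_opp (d : ι × Fin 5) : ∃ q : ι × Fin 5, q.1 ≠ d.1 ∧ T.side q = T.side d :=
  (T.side_shared d.1 d.2).exists

/-- The dart of the neighbouring tile that shares its side with `d`. -/
def opp (d : ι × Fin 5) : ι × Fin 5 := (T.exists_opp d).choose

lemma opp_fst_ne (d : ι × Fin 5) : (T.opp d).1 ≠ d.1 := (T.exists_opp d).choose_spec.1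

lemma side_opp (d : ι × Fin 5) : T.side (T.opp d) = T.side d := (T.exists_opp d).choose_spec.2

lemma eq_opp {d q : ι × Fin 5} (h1 : q.1 ≠ d.1) (h2 : T.side q = T.side d) : q = T.opp d :=
  (T.side_shared d.1 d.2).unique ⟨h1, h2⟩ ⟨T.opp_fst_ne d, T.side_opp d⟩

lemma opp_opp (d : ι × Fin 5) : T.opp (T.opp d) = d :=
  (T.eq_opp (T.opp_fst_ne d).symm (T.side_opp d).symm).symm

lemma eq_or_eq_opp_of_side_eq {d q : ι × Fin 5} (h : T.side q = T.side d) :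
    q = d ∨ q = T.opp d := by
  by_cases h1 : q.1 = d.1
  · left
    obtain ⟨i, k⟩ := d
    obtain ⟨j, l⟩ := q
    obtain rfl : j = i := h1
    refine Prod.ext rfl (boundaryArc_injective ?_)
    exact ((T.chart_injOn j).image_eq_image_iff (boundaryArc_subset_closedBall _)
      (boundaryArc_subset_closedBall _)).1 h
  · exact Or.inr (T.eq_opp h1 h)

lemma vtx_next_opp (d : ι × Fin 5) : T.vtx (next (T.opp d)) = T.vtx d :=
  (T.counterclockwise d.1 d.2 (T.opp d).1 (T.opp d).2 (T.opp_fst_ne d).symm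
    (T.side_opp d).symm).1.symm

lemma vtx_opp (d : ι × Fin 5) : T.vtx (T.opp d) = T.vtx (next d) :=
  (T.counterclockwise d.1 d.2 (T.opp d).1 (T.opp d).2 (T.opp_fst_ne d).symm
    (T.side_opp d).symm).2.symm

lemma side_inter_subset {d q : ι × Fin 5} (h : T.side d ≠ T.side q) {x : S2}
    (hd : x ∈ T.side d) (hq : x ∈ T.side q) :
    (x = T.vtx d ∨ x = T.vtx (next d)) ∧ (x = T.vtx q ∨ x = T.vtx (next q)) := by
  rcases T.side_inter d.1 d.2 q.1 q.2 with h1 | h1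
  · exact absurd h1 h
  · exact h1 ⟨hd, hq⟩

/-- A vertex lies in no tile other than those that have a corner there. -/
lemma exists_vtx_eq_of_mem_tile {d : ι × Fin 5} {j : ι} (h : T.vtx d ∈ T.tile j) :
    ∃ l, T.vtx (j, l) = T.vtx d := by
  by_cases hj : j = d.1
  · exact ⟨d.2, by rw [hj]⟩
  obtain ⟨l, hl⟩ := T.mem_side_of_mem_tiles hj h (T.vtx_mem_tile d)
  by_cases hs : T.side d = T.side (j, l)
  · refine ⟨l + 1, ?_⟩
    rw [← T.vtx_next_opp d, ← T.eq_opp (d := d) hj hs.symm]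
    rfl
  · rcases (T.side_inter_subset hs (T.vtx_mem_side d) hl).2 with h | h
    · exact ⟨l, h.symm⟩
    · exact ⟨l + 1, h.symm⟩

/-! ### The angle sum at a vertex -/

open Classical in
/-- The darts that start at `v`, that is, the corners of tiles at `v`. -/
def dartsAt (v : S2) : Finset (ι × Fin 5) := Finset.univ.filter fun q => T.vtx q = v

lemma mem_dartsAt {v : S2} {q : ι × Fin 5} : q ∈ T.dartsAt v ↔ T.vtx q = v := by
  simp [dartsAt]

lemma aedisjoint_tile {i j : ι} (hij : i ≠ j) : AEDisjoint area (T.tile i) (T.tile j) := by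
  refine measure_mono_null (t := ⋃ k, T.side (i, k)) ?_ ?_
  · rintro x ⟨hi, hj⟩
    exact Set.mem_iUnion.2 (T.mem_side_of_mem_tiles hij hi hj)
  · exact measure_iUnion_null fun k => T.side_null i k

instance : IsFiniteMeasure area := by unfold area; infer_instance
instance : area.IsOpenPosMeasure := by unfold area; infer_instance

lemma eventually_ball_subset (d : ι × Fin 5) :
    ∀ᶠ r in 𝓝[>] (0 : ℝ), Metric.ball (T.vtx d) r ⊆ ⋃ q ∈ T.dartsAt (T.vtx d), T.tile q.1 := by
  let F : Set S2 := ⋃ j ∈ {j : ι | T.vtx d ∉ T.tile j}, T.tile j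
  have hF : IsClosed F := Set.Finite.isClosed_biUnion (Set.toFinite _) fun j _ => T.isClosed_tile j
  have hd : T.vtx d ∈ Fᶜ := by
    intro h
    simp only [F, Set.mem_iUnion] at h
    obtain ⟨j, hj, hj'⟩ := h
    exact hj hj'
  obtain ⟨ε, hε, hb⟩ := Metric.isOpen_iff.1 hF.isOpen_compl _ hd
  filter_upwards [Ioo_mem_nhdsGT hε] with r hr x hx
  have hxF := hb (Metric.ball_subset_ball hr.2.le hx)
  have hx' : x ∈ ⋃ i, T.tile i := by
    have := T.cover
    change (⋃ i, T.tile i) = _ at this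
    rw [this]; trivial
  obtain ⟨j, hj⟩ := Set.mem_iUnion.1 hx'
  have hdj : T.vtx d ∈ T.tile j := by
    by_contra hcon
    exact hxF (Set.mem_biUnion (show j ∈ {j : ι | T.vtx d ∉ T.tile j} from hcon) hj)
  obtain ⟨l, hl⟩ := T.exists_vtx_eq_of_mem_tile hdj
  exact Set.mem_biUnion (show (j, l) ∈ T.dartsAt (T.vtx d) from T.mem_dartsAt.2 hl) hj

/-- The angles at a vertex add up to `2π`: a small disc around the vertex is covered by the tiles
that have a corner there, and these overlap in sets of area zero. -/
theorem sum_angle_dartsAt (d : ι × Fin 5) :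
    ∑ q ∈ T.dartsAt (T.vtx d), T.angle q.1 q.2 = 2 * Real.pi := by
  set v := T.vtx d with hv
  have hlim : Tendsto (fun r : ℝ => ∑ q ∈ T.dartsAt v,
      2 * Real.pi * (area.real (T.tile q.1 ∩ Metric.ball v r) / area.real (Metric.ball v r)))
      (𝓝[>] 0) (𝓝 (∑ q ∈ T.dartsAt v, T.angle q.1 q.2)) := by
    refine tendsto_finsetSum _ fun q hq => ?_
    have := T.hasInteriorAngle q.1 q.2
    rw [HasInteriorAngle] at this
    rw [← T.mem_dartsAt.1 hq]
    exact this
  refine tendsto_nhds_unique hlim (tendsto_const_nhds.congr' ?_)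
  filter_upwards [T.eventually_ball_subset d, self_mem_nhdsWithin] with r hr hr0
  rw [← Finset.mul_sum, ← Finset.sum_div]
  have hpos : area.real (Metric.ball v r) ≠ 0 :=
    (ENNReal.toReal_pos (Metric.measure_ball_pos area v hr0).ne' (measure_ne_top _ _)).ne'
  have hsum : area.real (Metric.ball v r) =
      ∑ q ∈ T.dartsAt v, area.real (T.tile q.1 ∩ Metric.ball v r) := by
    rw [← measureReal_biUnion_finset₀]
    · congr 1
      rw [← Set.iUnion₂_inter, Set.inter_eq_right.2 hr]
    · intro q hq q' hq' hne
      refine (T.aedisjoint_tile fun h => hne ?_).mono Set.inter_subset_left Set.inter_subset_left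
      exact T.eq_of_vtx_eq ((T.mem_dartsAt.1 hq).trans (T.mem_dartsAt.1 hq').symm) h
    · intro q _
      exact ((T.isClosed_tile q.1).measurableSet.inter
        Metric.isOpen_ball.measurableSet).nullMeasurableSet
  rw [← hsum, div_self hpos, mul_one]

end PentagonTiling

/-! ### Euler's inequality -/

lemma isPreconnected_puncturedDisc : IsPreconnected (Metric.ball (0 : ℂ) 1 \ {0}) := by
  have h : IsPreconnected ((fun x : ℝ × ℝ => (x.1 : ℂ) * Complex.exp (x.2 * Complex.I)) ''
      (Set.Ioo 0 1 ×ˢ Set.univ)) :=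
    (isPreconnected_Ioo.prod isPreconnected_univ).image _ (by fun_prop)
  convert h using 1
  ext z
  simp only [Set.mem_sdiff, Metric.mem_ball, dist_zero_right, Set.mem_singleton_iff, Set.mem_image,
    Set.mem_prod, Set.mem_Ioo, Set.mem_univ, and_true, Prod.exists]
  constructor
  · rintro ⟨h1, h2⟩
    exact ⟨‖z‖, z.arg, ⟨norm_pos_iff.2 h2, h1⟩, Complex.norm_mul_exp_arg_mul_I z⟩
  · rintro ⟨r, θ, ⟨h0, h1⟩, rfl⟩
    refine ⟨?_, mul_ne_zero (by exact_mod_cast h0.ne') (Complex.exp_ne_zero _)⟩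
    rw [norm_mul, Complex.norm_exp_ofReal_mul_I, mul_one, Complex.norm_real, Real.norm_eq_abs,
      abs_of_pos h0]
    exact h1

lemma closedBall_subset_closure_puncturedDisc :
    Metric.closedBall (0 : ℂ) 1 ⊆ closure (Metric.ball (0 : ℂ) 1 \ {0}) := by
  rw [← closure_ball (0 : ℂ) one_ne_zero]
  exact closure_minimal
    ((dense_compl_singleton (0 : ℂ)).open_subset_closure_inter Metric.isOpen_ball) isClosed_closure

/-- A forest with a nonempty vertex set `V` has fewer edges than vertices. That the edges form a forest
is expressed by functions `χ e` on the vertices that jump along `e` and along no other edge; together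
with the constant function they are linearly independent. -/
lemma card_add_one_le_card_of_separating {V E : Type*} [Fintype V] [Nonempty V] [Fintype E]
    (s t : E → V) (χ : E → V → ℝ) (h : ∀ e, χ e (s e) ≠ χ e (t e))
    (h' : ∀ e e', e' ≠ e → χ e (s e') = χ e (t e')) :
    Fintype.card E + 1 ≤ Fintype.card V := by
  let f : Option E → V → ℝ := fun o => o.elim (fun _ => 1) χ
  have hf : LinearIndependent ℝ f := by
    rw [Fintype.linearIndependent_iff]
    intro g hg
    have hv : ∀ v, g none + ∑ e, g (some e) * χ e v = 0 := fun v => by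
      have := congrFun hg v
      simpa [Fintype.sum_option, f] using this
    have hs : ∀ e, g (some e) = 0 := by
      intro e
      have h1 : ∑ e', g (some e') * (χ e' (s e) - χ e' (t e)) = 0 := by
        simp only [mul_sub, Finset.sum_sub_distrib]
        linarith [hv (s e), hv (t e)]
      rw [Finset.sum_eq_single e] at h1
      · exact (mul_eq_zero.1 h1).resolve_right (sub_ne_zero.2 (h e))
      · intro e' _ hne
        rw [h' e' e hne.symm, sub_self, mul_zero]
      · simp
    rintro (_ | e)
    · obtain ⟨v⟩ := ‹Nonempty V›
      simpa [hs] using hv v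
    · exact hs e
  simpa using hf.fintype_card_le_finrank

namespace PentagonTiling

variable {ι : Type*} [Fintype ι] (T : PentagonTiling ι)

/-- The dual graph: the tiles, two of them being adjacent if they share a side. -/
def dual : SimpleGraph ι where
  Adj i j := ∃ k, (T.opp (i, k)).1 = j
  symm := ⟨by
    rintro i j ⟨k, rfl⟩
    exact ⟨(T.opp (i, k)).2, by simp [T.opp_opp]⟩⟩
  loopless := ⟨fun i ⟨k, hk⟩ => T.opp_fst_ne (i, k) hk⟩

lemma iUnion_tile : ⋃ i, T.tile i = Set.univ := T.cover

lemma notMem_side_of_mem_openTile {i : ι} {x : S2} (hx : x ∈ T.openTile i) (d : ι × Fin 5) :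
    x ∉ T.side d := fun h => Set.disjoint_left.1 (T.disjoint_openTile_side i d) hx h

lemma center_mem_openTile (i : ι) : T.chart i 0 ∈ T.openTile i := ⟨0, by simp, rfl⟩

/-- Otherwise the tiles would fall into two classes whose unions are closed sets meeting only in
vertices, but the sphere minus the finitely many vertices is connected. -/
lemma dual_connected [Nonempty ι] : T.dual.Connected := by
  refine ⟨fun i₀ j₀ => ?_⟩
  by_contra hcon
  let A : Set S2 := ⋃ i ∈ {i | T.dual.Reachable i₀ i}, T.tile i
  let B : Set S2 := ⋃ i ∈ {i | ¬ T.dual.Reachable i₀ i}, T.tile i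
  have hA : IsClosed A := Set.Finite.isClosed_biUnion (Set.toFinite _) fun j _ => T.isClosed_tile j
  have hB : IsClosed B := Set.Finite.isClosed_biUnion (Set.toFinite _) fun j _ => T.isClosed_tile j
  have hconn : IsPreconnected (Set.range T.vtx)ᶜ :=
    isPreconnected_compl_of_finite (Set.finite_range _) ⟨(i₀, 0), rfl⟩
  have hcenter : ∀ i, T.chart i 0 ∈ (Set.range T.vtx)ᶜ := by
    rintro i ⟨d, hd⟩
    exact T.notMem_side_of_mem_openTile (T.center_mem_openTile i) d (hd ▸ T.vtx_mem_side d)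
  obtain ⟨x, hx, hxA, hxB⟩ := isPreconnected_closed_iff.1 hconn A B hA hB
    (fun x _ => by
      obtain ⟨i, hi⟩ := Set.mem_iUnion.1 (T.iUnion_tile.symm ▸ Set.mem_univ x : x ∈ ⋃ i, T.tile i)
      by_cases h : T.dual.Reachable i₀ i
      · exact Or.inl (Set.mem_biUnion (show i ∈ {i | T.dual.Reachable i₀ i} from h) hi)
      · exact Or.inr (Set.mem_biUnion (show i ∈ {i | ¬ T.dual.Reachable i₀ i} from h) hi))
    ⟨_, hcenter i₀, Set.mem_biUnion (show i₀ ∈ {i | T.dual.Reachable i₀ i} from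
      SimpleGraph.Reachable.refl _) (T.openTile_subset_tile _ (T.center_mem_openTile i₀))⟩
    ⟨_, hcenter j₀, Set.mem_biUnion (show j₀ ∈ {i | ¬ T.dual.Reachable i₀ i} from hcon)
      (T.openTile_subset_tile _ (T.center_mem_openTile j₀))⟩
  simp only [A, B, Set.mem_iUnion, Set.mem_ofPred_eq, exists_prop] at hxA hxB
  obtain ⟨i, hi, hxi⟩ := hxA
  obtain ⟨j, hj, hxj⟩ := hxB
  have hij : i ≠ j := by rintro rfl; exact hj hi
  obtain ⟨k, hk⟩ := T.mem_side_of_mem_tiles hij hxi hxj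
  obtain ⟨l, hl⟩ := T.mem_side_of_mem_tiles hij.symm hxj hxi
  by_cases hs : T.side (j, l) = T.side (i, k)
  · refine hj (hi.trans (SimpleGraph.Adj.reachable ⟨k, ?_⟩))
    rw [← T.eq_opp (d := (i, k)) (q := (j, l)) hij.symm hs]
  · rcases (T.side_inter_subset hs hl hk).1 with h | h
    · exact hx ⟨_, h.symm⟩
    · exact hx ⟨_, h.symm⟩

/-! ### Open sides -/

/-- A side without its end points. -/
def openSide (d : ι × Fin 5) : Set S2 := T.chart d.1 '' (boundaryPoint d.2 '' Set.Ioo 0 1)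

lemma openSide_eq (d : ι × Fin 5) : T.openSide d = T.side d \ {T.vtx d, T.vtx (next d)} := by
  have hv : T.vtx (next d) = T.chart d.1 (boundaryPoint d.2 1) := by
    rw [boundaryPoint_one]; rfl
  have hinj : ∀ s t : ℝ, T.chart d.1 (boundaryPoint d.2 s) = T.chart d.1 (boundaryPoint d.2 t) →
      boundaryPoint d.2 s = boundaryPoint d.2 t := fun s t h =>
    T.chart_injOn d.1 (boundaryPoint_mem_closedBall _ _) (boundaryPoint_mem_closedBall _ _) h
  ext x
  constructor
  · rintro ⟨_, ⟨s, hs, rfl⟩, rfl⟩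
    refine ⟨⟨_, ⟨s, ⟨hs.1.le, hs.2.le⟩, rfl⟩, rfl⟩, ?_⟩
    rintro (h | h)
    · have := (boundaryPoint_inj ⟨hs.1.le, hs.2⟩ (by norm_num) (hinj s 0 h)).2
      exact hs.1.ne' this
    · rw [Set.mem_singleton_iff, hv] at h
      have h1 := hinj s 1 h
      rw [boundaryPoint_one] at h1
      have := (boundaryPoint_inj ⟨hs.1.le, hs.2⟩ (by norm_num) h1).1
      simp at this
  · rintro ⟨⟨_, ⟨s, hs, rfl⟩, rfl⟩, hx⟩
    refine ⟨_, ⟨s, ⟨lt_of_le_of_ne hs.1 ?_, lt_of_le_of_ne hs.2 ?_⟩, rfl⟩, rfl⟩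
    · rintro rfl; exact hx (Or.inl rfl)
    · rintro rfl; exact hx (Or.inr hv.symm)

lemma openSide_opp (d : ι × Fin 5) : T.openSide (T.opp d) = T.openSide d := by
  rw [openSide_eq, openSide_eq, T.side_opp, T.vtx_opp, T.vtx_next_opp, Set.pair_comm]

lemma openSide_nonempty (d : ι × Fin 5) : (T.openSide d).Nonempty :=
  ⟨_, _, ⟨1 / 2, by norm_num, rfl⟩, rfl⟩

lemma openSide_subset_side (d : ι × Fin 5) : T.openSide d ⊆ T.side d := by
  rw [openSide_eq]; exact Set.sdiff_subset

lemma notMem_side_of_mem_openSide {d q : ι × Fin 5} (h1 : d ≠ q) (h2 : d ≠ T.opp q) {x : S2}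
    (hx : x ∈ T.openSide d) : x ∉ T.side q := by
  intro hq
  have hs : T.side d ≠ T.side q := fun h => (T.eq_or_eq_opp_of_side_eq h).elim h1 h2
  rw [openSide_eq] at hx
  rcases (T.side_inter_subset hs hx.1 hq).1 with h | h
  · exact hx.2 (Or.inl h)
  · exact hx.2 (Or.inr h)

/-! ### Complements of spanning trees -/

/-- A dart as a path on the sphere. -/
def sidePath (d : ι × Fin 5) : Path (T.vtx d) (T.vtx (next d)) where
  toFun s := T.chart d.1 (boundaryPoint d.2 s)
  continuous_toFun := (T.chart_continuousOn d.1).comp_continuous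
    ((continuous_boundaryPoint _).comp continuous_subtype_val)
    fun _ => boundaryPoint_mem_closedBall _ _
  source' := rfl
  target' := by
    change T.chart d.1 (boundaryPoint d.2 1) = _
    rw [boundaryPoint_one]; rfl

lemma sidePath_mem (d : ι × Fin 5) (s : unitInterval) : T.sidePath d s ∈ T.side d :=
  ⟨_, ⟨s, s.2, rfl⟩, rfl⟩

/-- The tile `i` without its boundary circle and its centre, together with its open sides in `X`.
The centre is left out because it serves as the centre of stereographic projection. -/
def openPiece (X : Set (ι × Fin 5)) (i : ι) : Set S2 :=
  T.chart i '' ((Metric.ball 0 1 \ {0}) ∪ ⋃ k ∈ {k | (i, k) ∈ X}, boundaryPoint k '' Set.Ioo 0 1)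

lemma mem_openPiece {X : Set (ι × Fin 5)} {i : ι} {x : S2} (hx : x ∈ T.openPiece X i) :
    (x ∈ T.openTile i ∧ x ≠ T.chart i 0) ∨ ∃ d ∈ X, x ∈ T.openSide d := by
  obtain ⟨z, hz | hz, rfl⟩ := hx
  · refine Or.inl ⟨⟨z, hz.1, rfl⟩, fun h => hz.2 ?_⟩
    exact T.chart_injOn i (Metric.ball_subset_closedBall hz.1) (by simp) h
  · simp only [Set.mem_iUnion] at hz
    obtain ⟨k, hk, hz⟩ := hz
    exact Or.inr ⟨(i, k), hk, _, hz, rfl⟩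

lemma isPreconnected_openPiece (X : Set (ι × Fin 5)) (i : ι) :
    IsPreconnected (T.openPiece X i) := by
  have hsub : ((Metric.ball (0 : ℂ) 1 \ {0}) ∪
      ⋃ k ∈ {k | (i, k) ∈ X}, boundaryPoint k '' Set.Ioo 0 1) ⊆ Metric.closedBall 0 1 := by
    refine Set.union_subset (Set.sdiff_subset.trans Metric.ball_subset_closedBall) ?_
    refine Set.iUnion₂_subset fun k _ => ?_
    rintro _ ⟨s, -, rfl⟩
    exact boundaryPoint_mem_closedBall k s
  refine IsPreconnected.image ?_ _ ((T.chart_continuousOn i).mono hsub)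
  exact isPreconnected_puncturedDisc.subset_closure Set.subset_union_left
    (hsub.trans closedBall_subset_closure_puncturedDisc)

lemma tile_subset_closure_openPiece (X : Set (ι × Fin 5)) (i : ι) :
    T.tile i ⊆ closure (T.openPiece X i) := by
  have hc : closure (Metric.ball (0 : ℂ) 1 \ {0}) ⊆ Metric.closedBall 0 1 :=
    closure_minimal (Set.sdiff_subset.trans Metric.ball_subset_closedBall) Metric.isClosed_closedBall
  refine (Set.image_mono closedBall_subset_closure_puncturedDisc).trans ?_
  refine ((T.chart_continuousOn i).mono hc).image_closure.trans (closure_mono ?_)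
  exact Set.image_mono Set.subset_union_left

/-- Let `X` be a set of sides across which all tiles are connected with each other, and let `e` be
a side outside `X`. Then the end points of `e` are not joined by other sides outside `X`: such a
connection would form a closed curve with `e`, but the complement of this curve contains the union
of all open tiles and open sides in `X`, which is connected and dense. -/
theorem not_joinedIn_of_notMem {X : Set (ι × Fin 5)} (hX : ∀ d ∈ X, T.opp d ∈ X)
    (hconn : ∀ i j, Relation.ReflTransGen (fun i j => ∃ d ∈ X, d.1 = i ∧ (T.opp d).1 = j) i j)
    {e : ι × Fin 5} (he : e ∉ X) :
    ¬ JoinedIn (⋃ d ∈ {d | d ∉ X ∧ d ≠ e ∧ d ≠ T.opp e}, T.side d)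
      (T.vtx e) (T.vtx (next e)) := by
  intro hJ
  have hγ₂ : ∀ x ∈ Set.range hJ.somePath, ∃ d, d ∉ X ∧ d ≠ e ∧ d ≠ T.opp e ∧ x ∈ T.side d := by
    rintro _ ⟨t, rfl⟩
    have := hJ.somePath_mem t
    simp only [Set.mem_iUnion, Set.mem_ofPred_eq, exists_prop] at this
    obtain ⟨d, ⟨h1, h2, h3⟩, h4⟩ := this
    exact ⟨d, h1, h2, h3, h4⟩
  have hγ₁ : ∀ x ∈ Set.range (T.sidePath e), x ∈ T.side e := by
    rintro _ ⟨t, rfl⟩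
    exact T.sidePath_mem e t
  have hn := T.notMem_side_of_mem_openTile (T.center_mem_openTile e.1)
  refine not_isPreconnected_compl_of_paths (n := T.chart e.1 0) (T.vtx_next_ne e) (T.sidePath e)
    hJ.somePath (fun h => hn _ (hγ₁ _ h)) (fun h => ?_) ?_ ?_
  · obtain ⟨d, -, -, -, hd⟩ := hγ₂ _ h
    exact hn d hd
  · rintro x ⟨h1, h2⟩
    obtain ⟨d, -, hd1, hd2, hd⟩ := hγ₂ _ h2
    have hs : T.side e ≠ T.side d := fun h => (T.eq_or_eq_opp_of_side_eq h.symm).elim hd1 hd2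
    exact (T.side_inter_subset hs (hγ₁ _ h1) hd).1
  · -- The closed curve and the centre of projection avoid a connected dense set.
    have hW : IsPreconnected (⋃ i, T.openPiece X i) := by
      refine IsPreconnected.iUnion_of_reflTransGen (T.isPreconnected_openPiece X) fun i j => ?_
      refine (hconn i j).lift id ?_
      rintro i j ⟨d, hd, rfl, rfl⟩
      obtain ⟨x, hx⟩ := T.openSide_nonempty d
      have key : ∀ q ∈ X, T.openSide q ⊆ T.openPiece X q.1 := by
        intro q hq
        refine Set.image_mono (Set.subset_union_of_subset_right ?_ _)
        exact Set.subset_biUnion_of_mem (u := fun k => boundaryPoint k '' Set.Ioo 0 1)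
          (show q.2 ∈ {k | (q.1, k) ∈ X} from hq)
      exact ⟨x, key d hd hx, key _ (hX d hd) ((T.openSide_opp d).symm ▸ hx)⟩
    refine hW.subset_closure ?_ ?_
    · refine Set.iUnion_subset fun i x hx => ?_
      rcases T.mem_openPiece hx with ⟨h1, h2⟩ | ⟨d, hd, hxd⟩
      · rintro ((h | h) | h)
        · exact T.notMem_side_of_mem_openTile h1 _ (hγ₁ _ h)
        · obtain ⟨q, -, -, -, hq⟩ := hγ₂ _ h
          exact T.notMem_side_of_mem_openTile h1 _ hq
        · by_cases hi : i = e.1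
          · subst hi; exact h2 h
          · refine Set.disjoint_left.1 (T.interior_disjoint i e.1 hi) h1 ?_
            rw [show x = _ from h]
            exact T.openTile_subset_tile _ (T.center_mem_openTile _)
      · have hne : ∀ q, q ∉ X → x ∉ T.side q := fun q hq =>
          T.notMem_side_of_mem_openSide (by rintro rfl; exact hq hd)
            (by rintro rfl; exact hq (T.opp_opp q ▸ hX _ hd)) hxd
        rintro ((h | h) | h)
        · exact hne e he (hγ₁ _ h)
        · obtain ⟨q, hq, -, -, hxq⟩ := hγ₂ _ h
          exact hne q hq hxq
        · rw [show x = _ from h] at hxd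
          exact hn d (T.openSide_subset_side d hxd)
    · intro x _
      obtain ⟨i, hi⟩ := Set.mem_iUnion.1 (T.iUnion_tile.symm ▸ Set.mem_univ x : x ∈ ⋃ i, T.tile i)
      exact closure_mono (Set.subset_iUnion _ i) (T.tile_subset_closure_openPiece X i hi)

/-! ### Counting -/

/-- If `E` contains one dart of each side, there are `5 / 2` sides per tile. -/
lemma card_eq_two_mul_of_orientation [DecidableEq ι] {E : Finset (ι × Fin 5)}
    (hE : ∀ d, d ∈ E ↔ T.opp d ∉ E) : 5 * Fintype.card ι = 2 * E.card := by
  have h1 : Eᶜ = E.map ⟨T.opp, fun a b h => by rw [← T.opp_opp a, h, T.opp_opp]⟩ := by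
    ext d
    simp only [Finset.mem_compl, Finset.mem_map]
    constructor
    · intro h
      exact ⟨T.opp d, by rw [hE, T.opp_opp]; exact h, T.opp_opp d⟩
    · rintro ⟨q, hq, rfl⟩
      exact (hE q).1 hq
  have h2 := Finset.card_add_card_compl E
  rw [h1, Finset.card_map, Fintype.card_prod, Fintype.card_fin] at h2
  omega

/-- The inequality `F - E + V ≥ 2`, multiplied by `2`, where `F` is the number of tiles and
`E = 5 F / 2` the number of sides: the sides not crossed by a spanning tree of the dual graph form a
forest. -/
theorem euler_inequality [Nonempty ι] :
    5 * Fintype.card ι + 4 ≤ 2 * (Set.range T.vtx).ncard + 2 * Fintype.card ι := by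
  classical
  let ord := Fintype.equivFin ι
  let E : Finset (ι × Fin 5) := Finset.univ.filter fun d => ord d.1 < ord (T.opp d).1
  have hE : ∀ d, d ∈ E ↔ T.opp d ∉ E := by
    intro d
    have hne : ord (T.opp d).1 ≠ ord d.1 := fun h => T.opp_fst_ne d (ord.injective h)
    simp only [E, Finset.mem_filter, Finset.mem_univ, true_and, T.opp_opp, not_lt]
    exact ⟨le_of_lt, fun h => lt_of_le_of_ne h hne.symm⟩
  obtain ⟨G, hG, htree⟩ := T.dual_connected.exists_isTree_le
  have hrep : ∀ a : G.edgeSet, ∃ d ∈ E, s(d.1, (T.opp d).1) = (a : Sym2 ι) := by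
    rintro ⟨a, ha⟩
    induction a using Sym2.ind with
    | _ i j =>
      obtain ⟨k, rfl⟩ := hG ((SimpleGraph.mem_edgeSet G).1 ha)
      by_cases h : (i, k) ∈ E
      · exact ⟨_, h, rfl⟩
      · refine ⟨T.opp (i, k), by rw [hE, T.opp_opp]; exact h, ?_⟩
        simp only [T.opp_opp]
        exact Sym2.eq_swap
  choose f hfE hf using hrep
  have hfinj : Function.Injective f := fun a b h => Subtype.ext (by rw [← hf a, ← hf b, h])
  let X₀ : Finset (ι × Fin 5) := Finset.univ.image f
  have hX₀ : X₀ ⊆ E := by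
    intro d hd
    obtain ⟨a, -, rfl⟩ := Finset.mem_image.1 hd
    exact hfE a
  have hX₀card : X₀.card + 1 = Fintype.card ι := by
    rw [Finset.card_image_of_injective _ hfinj, Finset.card_univ, ← htree.card_edgeFinset,
      SimpleGraph.edgeFinset_card]
  let X : Set (ι × Fin 5) := {d | d ∈ X₀ ∨ T.opp d ∈ X₀}
  have hX : ∀ d ∈ X, T.opp d ∈ X := by
    rintro d (h | h)
    · exact Or.inr (by rw [T.opp_opp]; exact h)
    · exact Or.inl h
  have hXconn : ∀ i j,
      Relation.ReflTransGen (fun i j => ∃ d ∈ X, d.1 = i ∧ (T.opp d).1 = j) i j := by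
    intro i j
    refine ((SimpleGraph.reachable_iff_reflTransGen i j).1
      (htree.connected.preconnected i j)).lift id ?_
    intro i j hij
    have hd := hf ⟨s(i, j), hij⟩
    have hmem : f ⟨s(i, j), hij⟩ ∈ X₀ := Finset.mem_image_of_mem _ (Finset.mem_univ _)
    rcases Sym2.eq_iff.1 hd with ⟨h1, h2⟩ | ⟨h1, h2⟩
    · exact ⟨_, Or.inl hmem, h1, h2⟩
    · refine ⟨T.opp (f ⟨s(i, j), hij⟩), Or.inr (by rw [T.opp_opp]; exact hmem), h2, ?_⟩
      rw [T.opp_opp]; exact h1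
  let R : Finset (ι × Fin 5) := E \ X₀
  have hRX : ∀ e ∈ R, e ∉ X := by
    intro e he
    rw [Finset.mem_sdiff] at he
    rintro (h | h)
    · exact he.2 h
    · exact (hE e).1 he.1 (hX₀ h)
  let F : ι × Fin 5 → Set S2 := fun e => ⋃ d ∈ {d | d ∉ X ∧ d ≠ e ∧ d ≠ T.opp e}, T.side d
  -- `χ e` is the indicator function of the component of the start of `e` when `e` is removed. The
  -- start is named separately since it need not lie in `F e`.
  let χ : R → Set.range T.vtx → ℝ := fun e v =>
    if (v : S2) = T.vtx e ∨ JoinedIn (F e) (T.vtx e) v then 1 else 0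
  have hcount := card_add_one_le_card_of_separating
    (fun e : R => (⟨T.vtx e, _, rfl⟩ : Set.range T.vtx))
    (fun e : R => (⟨T.vtx (next e), _, rfl⟩ : Set.range T.vtx)) χ ?_ ?_
  · have h1 := T.card_eq_two_mul_of_orientation hE
    have h2 : R.card + X₀.card = E.card := Finset.card_sdiff_add_card_eq_card hX₀
    rw [Fintype.card_coe, ← Nat.card_eq_fintype_card, Nat.card_coe_set_eq] at hcount
    omega
  · rintro ⟨e, he⟩
    have hnot := T.not_joinedIn_of_notMem hX hXconn (hRX e he)
    simp only [χ, true_or, if_true]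
    rw [if_neg]
    · norm_num
    · rintro (h | h)
      · exact T.vtx_next_ne e h.symm
      · exact hnot h
  · rintro ⟨e, he⟩ ⟨e', he'⟩ hne
    have hne1 : e' ≠ e := fun h => hne (Subtype.ext h)
    have hne2 : e' ≠ T.opp e := by
      rintro rfl
      exact (hE e).1 (Finset.mem_sdiff.1 he).1 (Finset.mem_sdiff.1 he').1
    have hsub : T.side e' ⊆ F e := Set.subset_biUnion_of_mem
      (show e' ∈ {d | d ∉ X ∧ d ≠ e ∧ d ≠ T.opp e} from ⟨hRX e' he', hne1, hne2⟩)
    have hJ : JoinedIn (F e) (T.vtx e') (T.vtx (next e')) :=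
      ⟨T.sidePath e', fun t => hsub (T.sidePath_mem e' t)⟩
    have hiff : (T.vtx e' = T.vtx e ∨ JoinedIn (F e) (T.vtx e) (T.vtx e')) ↔
        (T.vtx (next e') = T.vtx e ∨ JoinedIn (F e) (T.vtx e) (T.vtx (next e'))) := by
      constructor
      · rintro (h | h)
        · exact Or.inr (h ▸ hJ)
        · exact Or.inr (h.trans hJ)
      · rintro (h | h)
        · exact Or.inr (h ▸ hJ.symm)
        · exact Or.inr (h.trans hJ.symm)
    simp only [χ, hiff]

end PentagonTiling

/-! ### Vertices of degree three and the dodecahedron -/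

namespace PentagonTiling

variable {ι : Type*} [Fintype ι] (T : PentagonTiling ι)

/-- The next dart that starts at the same vertex. -/
def rot (d : ι × Fin 5) : ι × Fin 5 := next (T.opp d)

lemma next_injective {κ : Type*} : Function.Injective (next (ι := κ)) := by
  rintro ⟨i, k⟩ ⟨j, l⟩ h
  simpa [next] using h

lemma opp_injective : Function.Injective T.opp := fun a b h => by
  rw [← T.opp_opp a, h, T.opp_opp]

lemma rot_injective : Function.Injective T.rot := next_injective.comp T.opp_injective

lemma vtx_rot (d : ι × Fin 5) : T.vtx (T.rot d) = T.vtx d := T.vtx_next_opp d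

lemma rot_ne (d : ι × Fin 5) : T.rot d ≠ d := fun h => T.opp_fst_ne d (congrArg (fun q => q.1) h)

lemma three_le_card_dartsAt (d : ι × Fin 5) : 3 ≤ (T.dartsAt (T.vtx d)).card := by
  classical
  have h := T.three_le_degree d.1 d.2
  rw [Nat.card_eq_fintype_card, Fintype.card_subtype] at h
  convert h using 2
  ext q
  rw [T.mem_dartsAt, Finset.mem_filter]
  exact (and_iff_right (Finset.mem_univ _)).symm

/-- Every vertex has degree exactly `3`: the degrees add up to `60`, and there are at least `20`
vertices by Euler's inequality. -/
theorem card_dartsAt (hcard : Fintype.card ι = 12) (d : ι × Fin 5) :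
    (T.dartsAt (T.vtx d)).card = 3 := by
  classical
  have : Nonempty ι := ⟨d.1⟩
  have hE := T.euler_inequality
  let V : Finset S2 := Finset.univ.image T.vtx
  have hV : (Set.range T.vtx).ncard = V.card := by
    rw [← Set.ncard_coe_finset]; simp [V]
  rw [hV, hcard] at hE
  have hsum : ∑ v ∈ V, (T.dartsAt v).card = 60 := by
    have h := Finset.card_eq_sum_card_image T.vtx (Finset.univ : Finset (ι × Fin 5))
    rw [Finset.card_univ, Fintype.card_prod, hcard, Fintype.card_fin] at h
    rw [show (60 : ℕ) = 12 * 5 from rfl, h]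
    refine Finset.sum_congr rfl fun v _ => ?_
    congr 1
  have hge : ∀ v ∈ V, 3 ≤ (T.dartsAt v).card := by
    intro v hv
    obtain ⟨q, -, rfl⟩ := Finset.mem_image.1 hv
    exact T.three_le_card_dartsAt q
  -- At least `20` vertices of degree at least `3`, and `60` corners in all.
  have heq : ∑ v ∈ V, 3 = ∑ v ∈ V, (T.dartsAt v).card := by
    refine le_antisymm (Finset.sum_le_sum hge) ?_
    rw [hsum, Finset.sum_const, smul_eq_mul]
    omega
  exact ((Finset.sum_eq_sum_iff_of_le hge).1 heq _
    (Finset.mem_image_of_mem _ (Finset.mem_univ d))).symm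

lemma rot_rot_ne (hcard : Fintype.card ι = 12) (d : ι × Fin 5) : T.rot (T.rot d) ≠ d := by
  classical
  intro h
  have hlt : ({d, T.rot d} : Finset (ι × Fin 5)).card < (T.dartsAt (T.vtx d)).card := by
    rw [T.card_dartsAt hcard]
    exact Nat.lt_succ_of_le Finset.card_le_two
  have hsub : ({d, T.rot d} : Finset (ι × Fin 5)) ⊆ T.dartsAt (T.vtx d) := by
    intro q hq
    rw [T.mem_dartsAt]
    rcases Finset.mem_insert.1 hq with rfl | hq
    · rfl
    · rw [Finset.mem_singleton.1 hq, T.vtx_rot]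
  obtain ⟨c, hc, hc'⟩ := Finset.exists_mem_notMem_of_card_lt_card hlt
  simp only [Finset.mem_insert, Finset.mem_singleton, not_or] at hc'
  have hthree : ({d, T.rot d, c} : Finset (ι × Fin 5)) = T.dartsAt (T.vtx d) := by
    refine Finset.eq_of_subset_of_card_le ?_ ?_
    · intro q hq
      simp only [Finset.mem_insert, Finset.mem_singleton] at hq
      rcases hq with rfl | rfl | rfl
      · exact hsub (by simp)
      · exact hsub (by simp)
      · exact hc
    · rw [T.card_dartsAt hcard, Finset.card_eq_three.2
        ⟨d, T.rot d, c, (T.rot_ne d).symm, Ne.symm hc'.1, Ne.symm hc'.2, rfl⟩]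
  have hrc : T.rot c ∈ ({d, T.rot d, c} : Finset (ι × Fin 5)) := by
    rw [hthree, T.mem_dartsAt, T.vtx_rot, ← T.mem_dartsAt]
    exact hc
  simp only [Finset.mem_insert, Finset.mem_singleton] at hrc
  rcases hrc with h1 | h1 | h1
  · exact hc'.2 (T.rot_injective (h1.trans h.symm))
  · exact hc'.1 (T.rot_injective h1)
  · exact T.rot_ne c h1

lemma dartsAt_vtx [DecidableEq ι] (hcard : Fintype.card ι = 12) (d : ι × Fin 5) :
    T.dartsAt (T.vtx d) = {d, T.rot d, T.rot (T.rot d)} := by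
  symm
  refine Finset.eq_of_subset_of_card_le ?_ ?_
  · intro q hq
    simp only [Finset.mem_insert, Finset.mem_singleton] at hq
    rw [T.mem_dartsAt]
    rcases hq with rfl | rfl | rfl <;> simp only [T.vtx_rot]
  · rw [T.card_dartsAt hcard, Finset.card_eq_three.2
      ⟨d, T.rot d, _, (T.rot_ne d).symm, (T.rot_rot_ne hcard d).symm, (T.rot_ne _).symm, rfl⟩]

lemma vtx_eq_iff (hcard : Fintype.card ι = 12) (d q : ι × Fin 5) :
    T.vtx d = T.vtx q ↔ q = d ∨ q = T.rot d ∨ q = T.rot (T.rot d) := by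
  classical
  rw [eq_comm, ← T.mem_dartsAt, T.dartsAt_vtx hcard]
  simp

lemma rot_rot_rot (hcard : Fintype.card ι = 12) (d : ι × Fin 5) :
    T.rot (T.rot (T.rot d)) = d := by
  have h : T.vtx d = T.vtx (T.rot (T.rot (T.rot d))) := by simp only [T.vtx_rot]
  rcases (T.vtx_eq_iff hcard _ _).1 h with h | h | h
  · exact h
  · exact absurd (T.rot_injective h) (T.rot_rot_ne hcard d)
  · exact absurd h (T.rot_ne _)

lemma sum_angle_rot (hcard : Fintype.card ι = 12) (d : ι × Fin 5) :
    T.angle d.1 d.2 + T.angle (T.rot d).1 (T.rot d).2 +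
      T.angle (T.rot (T.rot d)).1 (T.rot (T.rot d)).2 = 2 * Real.pi := by
  classical
  have h := T.sum_angle_dartsAt d
  rw [T.dartsAt_vtx hcard, Finset.sum_insert, Finset.sum_insert, Finset.sum_singleton] at h
  · rw [← h]; ring
  · simpa using (T.rot_ne _).symm
  · simpa using ⟨(T.rot_ne d).symm, (T.rot_rot_ne hcard d).symm⟩

end PentagonTiling

/-! ### The darts of the dodecahedron -/

/-- The number of the side `k` of the face `i` of the dodecahedron, as a side of the neighbouring
face. -/
def dodecBack : Fin 12 → Fin 5 → Fin 5 :=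
  ![![0, 0, 0, 0, 0], ![0, 4, 4, 0, 1], ![1, 4, 4, 0, 1], ![2, 4, 4, 0, 1], ![3, 4, 4, 0, 1],
    ![4, 4, 4, 0, 1], ![3, 3, 4, 1, 2], ![3, 3, 3, 1, 2], ![3, 3, 2, 1, 2], ![3, 3, 1, 1, 2],
    ![3, 3, 0, 1, 2], ![2, 2, 2, 2, 2]]

/-- The dart of the dodecahedron opposite to `x`. -/
def dodecOpp (x : Fin 12 × Fin 5) : Fin 12 × Fin 5 :=
  (dodecNeighbour x.1 x.2, dodecBack x.1 x.2)

/-- The rotation of the darts of the dodecahedron around their starting vertices. -/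
def dodecRot (x : Fin 12 × Fin 5) : Fin 12 × Fin 5 := PentagonTiling.next (dodecOpp x)

lemma dodecOpp_dodecOpp : ∀ x, dodecOpp (dodecOpp x) = x := by decide +kernel

lemma dodecRot_rot_rot : ∀ x, dodecRot (dodecRot (dodecRot x)) = x := by decide +kernel

/-- An order in which the sides of the dodecahedron can be treated when the dodecahedron is laid out
over a tiling: rank `0` for the sides across which the faces are placed, and afterwards each dart
follows its opposite or the other two darts at its vertex. -/
def dodecRank : Fin 12 → Fin 5 → ℕ :=
  ![![0, 0, 0, 0, 0], ![1, 2, 4, 0, 3], ![1, 2, 4, 0, 3], ![1, 2, 4, 0, 3],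
    ![1, 2, 4, 0, 3], ![1, 2, 4, 0, 3], ![1, 6, 8, 7, 5], ![1, 6, 10, 7, 5],
    ![1, 6, 11, 7, 5], ![1, 6, 9, 7, 5], ![1, 6, 0, 7, 5], ![1, 8, 10, 11, 9]]

lemma dodecRank_spec : ∀ x : Fin 12 × Fin 5,
    x ∈ ([(0, 0), (0, 1), (0, 2), (0, 3), (0, 4), (1, 3), (2, 3), (3, 3), (4, 3), (5, 3), (10, 2)] :
      List (Fin 12 × Fin 5)) ∨
    dodecRank (dodecOpp x).1 (dodecOpp x).2 < dodecRank x.1 x.2 ∨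
    (dodecRank (dodecRot x).1 (dodecRot x).2 < dodecRank x.1 x.2 ∧
      dodecRank (dodecRot (dodecRot x)).1 (dodecRot (dodecRot x)).2 < dodecRank x.1 x.2) := by
  decide +kernel

namespace PentagonTiling

variable {ι : Type*} [Fintype ι] (T : PentagonTiling ι)

/-- The dart `k` steps further around the same tile. -/
def shift (d : ι × Fin 5) (k : Fin 5) : ι × Fin 5 := (d.1, d.2 + k)

/-- The darts of a tiling over which the side `0` of each face of the dodecahedron comes to lie when
the face `0` is put down at the dart `d` and the other faces are placed across sides already
present. Each face comes after a neighbour across its own side `0`. -/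
def placement (d : ι × Fin 5) : Fin 12 → ι × Fin 5 :=
  let a : Fin 5 → ι × Fin 5 := fun k => T.opp (shift d k)
  let b : Fin 5 → ι × Fin 5 := fun k => T.opp (shift (a k) 3)
  ![d, a 0, a 1, a 2, a 3, a 4, b 0, b 1, b 2, b 3, b 4, T.opp (shift (b 4) 2)]

/-- The map from the darts of the dodecahedron to those of the tiling given by `placement`. -/
def unfolding (d : ι × Fin 5) (x : Fin 12 × Fin 5) : ι × Fin 5 := shift (T.placement d x.1) x.2

lemma next_unfolding (d : ι × Fin 5) (x : Fin 12 × Fin 5) :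
    next (T.unfolding d x) = T.unfolding d (next x) := by
  simp [next, unfolding, shift, add_assoc]

/-- The unfolding respects opposite darts. For the sides across which faces are placed this is the
definition, and if it holds for two of the sides at a vertex of the dodecahedron it holds for the
third, because the vertices of the tiling have degree `3` as well. -/
lemma opp_unfolding (hcard : Fintype.card ι = 12) (d : ι × Fin 5) (x : Fin 12 × Fin 5) :
    T.opp (T.unfolding d x) = T.unfolding d (dodecOpp x) := by
  induction h : dodecRank x.1 x.2 using Nat.strong_induction_on generalizing x with
  | _ n ih =>
    subst h
    have hrot : ∀ y, T.opp (T.unfolding d y) = T.unfolding d (dodecOpp y) →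
        T.rot (T.unfolding d y) = T.unfolding d (dodecRot y) := by
      intro y hy
      rw [rot, hy, next_unfolding]; rfl
    rcases dodecRank_spec x with hx | hx | ⟨h1, h2⟩
    · have hz : ∀ q : ι × Fin 5, shift q 0 = q := fun q => by simp [shift]
      simp only [List.mem_cons, List.not_mem_nil, or_false] at hx
      rcases hx with rfl | rfl | rfl | rfl | rfl | rfl | rfl | rfl | rfl | rfl | rfl <;>
        exact (hz _).symm
    · have := ih _ hx (dodecOpp x) rfl
      rw [dodecOpp_dodecOpp] at this
      rw [← this, T.opp_opp]
    · have e1 := hrot _ (ih _ h1 (dodecRot x) rfl)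
      have e2 := hrot _ (ih _ h2 (dodecRot (dodecRot x)) rfl)
      rw [dodecRot_rot_rot, ← e1] at e2
      apply next_injective
      change T.rot (T.unfolding d x) = _
      rw [← e2, T.rot_rot_rot hcard, next_unfolding]
      rfl

lemma placement_surjective (hcard : Fintype.card ι = 12) (d : ι × Fin 5) :
    Function.Surjective fun i => (T.placement d i).1 := by
  intro j
  have : Nonempty ι := ⟨j⟩
  have hr := (SimpleGraph.reachable_iff_reflTransGen d.1 j).1
    (T.dual_connected.preconnected d.1 j)
  induction hr with
  | refl => exact ⟨0, rfl⟩
  | tail _ hadj ih =>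
    obtain ⟨i, rfl⟩ := ih
    obtain ⟨k, rfl⟩ := hadj
    have h := T.opp_unfolding hcard d (i, k - (T.placement d i).2)
    have h2 : T.unfolding d (i, k - (T.placement d i).2) = ((T.placement d i).1, k) := by
      simp [unfolding, shift]
    rw [h2] at h
    exact ⟨_, congrArg (fun q => q.1) h.symm⟩

/-- The tiling is combinatorially the dodecahedron, and the side `0` of the face `0` can be put at
any dart `d`. The side `k` of the face `i` corresponds to the side `o i + k` of the tile `τ i`. -/
theorem exists_dodecahedral_labelling (hcard : Fintype.card ι = 12) (d : ι × Fin 5) :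
    ∃ (τ : Fin 12 ≃ ι) (o : Fin 12 → Fin 5), τ 0 = d.1 ∧ o 0 = d.2 ∧
      ∀ x : Fin 12 × Fin 5, T.rot (τ x.1, o x.1 + x.2) =
        (τ (dodecRot x).1, o (dodecRot x).1 + (dodecRot x).2) := by
  have hb : Function.Bijective fun i => (T.placement d i).1 :=
    (Fintype.bijective_iff_surjective_and_card _).2
      ⟨T.placement_surjective hcard d, by rw [hcard, Fintype.card_fin]⟩
  refine ⟨Equiv.ofBijective _ hb, fun i => (T.placement d i).2, rfl, rfl, fun x => ?_⟩
  have h := congrArg next (T.opp_unfolding hcard d x)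
  rw [next_unfolding] at h
  exact h

end PentagonTiling

/-! ### The values of the angles -/

open AngleName

lemma sum_angleName (f : AngleName → ℝ) : ∑ n, f n = f α + f β + f γ + f δ + f ε := by
  have : (Finset.univ : Finset AngleName) = {α, β, γ, δ, ε} := rfl
  rw [this]
  simp only [Finset.sum_insert, Finset.mem_insert, Finset.mem_singleton, reduceCtorEq, or_self,
    not_false_eq_true, Finset.sum_singleton]
  ring

lemma exists_perm_angleName : ∀ P N : AngleName, P ≠ α → N ≠ α → P ≠ N →
    ∃ p : Equiv.Perm AngleName, p α = α ∧ p β = P ∧ p γ = N := by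
  intro P N hP hN hPN
  let p₁ : Equiv.Perm AngleName := Equiv.swap β P
  have h1 : p₁ β = P := Equiv.swap_apply_left _ _
  let p₂ : Equiv.Perm AngleName := Equiv.swap (p₁ γ) N
  have hα : p₁ α = α := Equiv.swap_apply_of_ne_of_ne (by decide) hP.symm
  refine ⟨p₁.trans p₂, ?_, ?_, ?_⟩
  · rw [Equiv.trans_apply, hα]
    refine Equiv.swap_apply_of_ne_of_ne ?_ hN.symm
    rw [← hα]
    exact fun h => absurd (p₁.injective h) (by decide)
  · rw [Equiv.trans_apply, h1]
    refine Equiv.swap_apply_of_ne_of_ne ?_ hPN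
    rw [← h1]
    exact fun h => absurd (p₁.injective h) (by decide)
  · exact Equiv.swap_apply_left _ _

section Classification

variable {D : Type*} [Fintype D] {ρ : D → D} {nm : D → AngleName}

/-- Double counting of corners by tiles and by vertices, when every angle occurs `12` times. -/
lemma sum_weight (hρ : Function.Injective ρ)
    (hnm : ∀ n, Fintype.card {d // nm d = n} = 12) (w : AngleName → ℝ) :
    ∑ d, (w (nm d) + w (nm (ρ d)) + w (nm (ρ (ρ d)))) = 36 * ∑ n, w n := by
  classical
  have hb : Function.Bijective ρ := Finite.injective_iff_bijective.1 hρ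
  have h1 : ∀ f : D → ℝ, ∑ d, f (ρ d) = ∑ d, f d := fun f => hb.sum_comp f
  have h2 : ∑ d, w (nm d) = 12 * ∑ n, w n := by
    rw [← Finset.sum_fiberwise_of_maps_to (s := Finset.univ) (t := Finset.univ) (g := nm)
      (fun _ _ => Finset.mem_univ _), Finset.mul_sum]
    refine Finset.sum_congr rfl fun n _ => ?_
    rw [Finset.sum_congr rfl (g := fun _ => w n) (fun d hd => by rw [(Finset.mem_filter.1 hd).2]),
      Finset.sum_const, ← Fintype.card_subtype, hnm, nsmul_eq_mul]
    norm_num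
  rw [Finset.sum_add_distrib, Finset.sum_add_distrib, h1 (fun d => w (nm (ρ d))),
    h1 (fun d => w (nm d)), h2]
  ring

lemma exists_vertex_weight_neg (hρ : Function.Injective ρ)
    (hnm : ∀ n, Fintype.card {d // nm d = n} = 12) {w : AngleName → ℝ} (hw : ∑ n, w n < 0) :
    ∃ d, w (nm d) + w (nm (ρ d)) + w (nm (ρ (ρ d))) < 0 := by
  by_contra! hcon
  have h1 := Finset.sum_nonneg (s := Finset.univ) fun d _ => hcon d
  rw [sum_weight hρ hnm] at h1
  linarith

/-- A vertex with a negative angle has a positive one, and at most two negative ones. So there are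
at most twice as many negative angles as positive ones. -/
lemma weight_two_pos_sub_neg_nonneg (hρ : Function.Injective ρ)
    (hnm : ∀ n, Fintype.card {d // nm d = n} = 12) {x : AngleName → ℝ}
    (hx : ∀ d, x (nm d) + x (nm (ρ d)) + x (nm (ρ (ρ d))) = 0) :
    0 ≤ ∑ n, ((if 0 < x n then 2 else 0) - (if x n < 0 then 1 else 0) : ℝ) := by
  by_contra! hcon
  obtain ⟨d, hd⟩ := exists_vertex_weight_neg hρ hnm hcon
  have h := hx d
  split_ifs at hd <;> linarith

/-- If at least two angles are positive, some vertex has two positive angles and one negative angle. -/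
lemma exists_two_pos (hρ : Function.Injective ρ)
    (hnm : ∀ n, Fintype.card {d // nm d = n} = 12) {x : AngleName → ℝ}
    (hx : ∀ d, x (nm d) + x (nm (ρ d)) + x (nm (ρ (ρ d))) = 0)
    (hw : ∑ n, (if 0 < x n then -2 else 1 : ℝ) < 0) :
    ∃ P P' N, 0 < x P ∧ 0 < x P' ∧ x N < 0 ∧ x P + x P' + x N = 0 := by
  obtain ⟨d, hd⟩ := exists_vertex_weight_neg hρ hnm hw
  have h := hx d
  split_ifs at hd with h1 h2 h3 h3 h2 h3 h3
  · linarith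
  · exact ⟨_, _, nm (ρ (ρ d)), h1, h2, by linarith, h⟩
  · exact ⟨_, _, nm (ρ d), h1, h3, by linarith, by linarith⟩
  · norm_num at hd
  · exact ⟨_, _, nm d, h2, h3, by linarith, by linarith⟩
  · norm_num at hd
  · norm_num at hd
  · norm_num at hd

/-- The values of the angles. Here `x n` is the excess of the angle `n` over `2π / 3`, `nm` gives the
name of the angle at each corner, and `ρ` rotates the corners around the vertices. Two of the values
are positive and two are negative; some vertex has angles `P, P, N` with `P > 0 > N`, and some vertex
has angles `N₁, N₁, P₁` with `P₁ > 0 > N₁`. Up to names this leaves three proportions of the values,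
and in two of them some angle does not fit at any vertex. -/
theorem angle_classification (hρ : Function.Injective ρ)
    (hnm : ∀ n, Fintype.card {d // nm d = n} = 12) {x : AngleName → ℝ}
    (hinj : Function.Injective x) (hα : x α = 0)
    (hx : ∀ d, x (nm d) + x (nm (ρ d)) + x (nm (ρ (ρ d))) = 0) :
    ∃ (p : Equiv.Perm AngleName) (t : ℝ), p α = α ∧ 0 < t ∧
      x (p β) = t ∧ x (p γ) = -2 * t ∧ x (p δ) = -t ∧ x (p ε) = 2 * t := by
  have hxneg : ∀ d, (-x) (nm d) + (-x) (nm (ρ d)) + (-x) (nm (ρ (ρ d))) = 0 := fun d => by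
    simp only [Pi.neg_apply]; linarith [hx d]
  have hsum : ∑ n, x n = 0 := by
    have h := sum_weight hρ hnm x
    rw [Finset.sum_eq_zero fun d _ => hx d] at h
    linarith
  have hne : ∀ n, n ≠ α → x n ≠ 0 := fun n hn h => hn (hinj (h.trans hα.symm))
  have hβ := hne β (by decide)
  have hγ := hne γ (by decide)
  have hδ := hne δ (by decide)
  have hε := hne ε (by decide)
  have hcount : ∀ y : AngleName → ℝ, y α = 0 → (∀ n, n ≠ α → y n ≠ 0) →
      ∑ n, ((if 0 < y n then 2 else 0) - (if y n < 0 then 1 else 0) : ℝ) =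
        3 * ∑ n, (if 0 < y n then 1 else 0 : ℝ) - 4 := by
    intro y hy hyn
    have : ∀ n, n ≠ α → ((if 0 < y n then 2 else 0) - (if y n < 0 then 1 else 0) : ℝ) =
        3 * (if 0 < y n then 1 else 0 : ℝ) - 1 := by
      intro n hn
      rcases lt_or_gt_of_ne (hyn n hn) with h | h
      · rw [if_neg h.not_gt, if_neg h.not_gt, if_pos h]; norm_num
      · rw [if_pos h, if_neg h.not_gt, if_pos h]; norm_num
    simp only [sum_angleName]
    rw [this β (by decide), this γ (by decide), this δ (by decide), this ε (by decide)]
    simp only [hy, lt_irrefl, if_false]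
    ring
  have hp := weight_two_pos_sub_neg_nonneg hρ hnm hx
  have hn := weight_two_pos_sub_neg_nonneg hρ hnm hxneg
  rw [hcount x hα hne] at hp
  rw [hcount (-x) (by simp [hα]) (by simpa using hne)] at hn
  have hpn : ∑ n, (if 0 < x n then 1 else 0 : ℝ) + ∑ n, (if 0 < (-x) n then 1 else 0 : ℝ) = 4 := by
    have : ∀ n, n ≠ α → (if 0 < x n then 1 else 0 : ℝ) + (if 0 < (-x) n then 1 else 0 : ℝ) = 1 := by
      intro n hn
      rcases lt_or_gt_of_ne (hne n hn) with h | h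
      · rw [if_neg h.not_gt, if_pos (by simpa using h)]; norm_num
      · rw [if_pos h, if_neg (by simpa using h.le)]; norm_num
    simp only [sum_angleName]
    have e1 := this β (by decide)
    have e2 := this γ (by decide)
    have e3 := this δ (by decide)
    have e4 := this ε (by decide)
    have e5 : (if 0 < x α then 1 else 0 : ℝ) = 0 := by simp [hα]
    have e6 : (if 0 < (-x) α then 1 else 0 : ℝ) = 0 := by simp [hα]
    linarith
  have hint : ∀ y : AngleName → ℝ, ∃ m : ℕ, ∑ n, (if 0 < y n then 1 else 0 : ℝ) = m := fun y =>
    ⟨∑ n, (if 0 < y n then 1 else 0), by push_cast; rfl⟩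
  -- There are two positive and two negative values: neither sign can occur only once.
  have htwo : ∑ n, (if 0 < x n then 1 else 0 : ℝ) = 2 ∧
      ∑ n, (if 0 < (-x) n then 1 else 0 : ℝ) = 2 := by
    obtain ⟨m, hm⟩ := hint x
    obtain ⟨m', hm'⟩ := hint (-x)
    rw [hm] at hp hpn ⊢
    rw [hm'] at hn hpn ⊢
    have h1 : m + m' = 4 := by exact_mod_cast hpn
    have h2 : 4 ≤ 3 * m := by
      have : (4 : ℝ) ≤ 3 * m := by linarith
      exact_mod_cast this
    have h3 : 4 ≤ 3 * m' := by
      have : (4 : ℝ) ≤ 3 * m' := by linarith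
      exact_mod_cast this
    have h4 : m = 2 := by omega
    have h5 : m' = 2 := by omega
    subst h4 h5
    norm_num
  have hwt : ∀ y : AngleName → ℝ, ∑ n, (if 0 < y n then 1 else 0 : ℝ) = 2 →
      ∑ n, (if 0 < y n then -2 else 1 : ℝ) < 0 := by
    intro y hy
    have : ∀ n, (if 0 < y n then -2 else 1 : ℝ) = 1 - 3 * (if 0 < y n then 1 else 0 : ℝ) := by
      intro n; split_ifs <;> norm_num
    simp only [this]
    rw [Finset.sum_sub_distrib, ← Finset.mul_sum, hy]
    simp only [Finset.sum_const, nsmul_eq_mul, mul_one]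
    have : (Finset.univ : Finset AngleName).card = 5 := rfl
    rw [this]; norm_num
  obtain ⟨P, P', N, hP, hP', hN, hPN⟩ := exists_two_pos hρ hnm hx (hwt x htwo.1)
  obtain ⟨N₁, N₂, P₁, hN₁, hN₂, hP₁, hNP⟩ := exists_two_pos hρ hnm hxneg (hwt _ htwo.2)
  simp only [Pi.neg_apply] at hN₁ hN₂ hP₁ hNP
  obtain ⟨p, hpα, hpβ, hpγ, hlt⟩ : ∃ p : Equiv.Perm AngleName, p α = α ∧ p β = P ∧ p γ = N ∧
      x (p δ) < x (p ε) := by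
    obtain ⟨p, h1, h2, h3⟩ := exists_perm_angleName P N (by rintro rfl; linarith)
      (by rintro rfl; linarith) (by rintro rfl; linarith)
    rcases lt_trichotomy (x (p δ)) (x (p ε)) with h | h | h
    · exact ⟨p, h1, h2, h3, h⟩
    · exact absurd (p.injective (hinj h)) (by decide)
    · refine ⟨(Equiv.swap δ ε).trans p, ?_, ?_, ?_, ?_⟩ <;> simp only [Equiv.trans_apply]
      · rw [Equiv.swap_apply_of_ne_of_ne (by decide) (by decide), h1]
      · rw [Equiv.swap_apply_of_ne_of_ne (by decide) (by decide), h2]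
      · rw [Equiv.swap_apply_of_ne_of_ne (by decide) (by decide), h3]
      · simpa using h
  have hs : x (p α) + x (p β) + x (p γ) + x (p δ) + x (p ε) = 0 := by
    rw [← sum_angleName (fun n => x (p n)), Equiv.sum_comp p x, hsum]
  have hnz : ∀ n, n ≠ α → x (p n) ≠ 0 := fun n hn => hne _ fun h =>
    hn (p.injective (h.trans hpα.symm))
  have hnδ := hnz δ (by decide)
  have hnε := hnz ε (by decide)
  have hnβ := hnz β (by decide)
  have hne2 : ∀ m n, m ≠ n → x (p m) ≠ x (p n) := fun m n hmn h => hmn (p.injective (hinj h))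
  rw [← hpβ] at hP hPN
  rw [← hpγ] at hN hPN
  rw [hpα, hα] at hs
  -- If `P'` were another angle than `P`, the sum over all angles would leave `0` for the fifth one.
  have hγβ : x (p γ) = -2 * x (p β) := by
    obtain ⟨q, rfl⟩ := p.surjective P'
    cases q
    · rw [hpα, hα] at hP'; linarith
    · linarith
    · linarith
    · exact absurd (show x (p ε) = 0 by linarith) hnε
    · exact absurd (show x (p δ) = 0 by linarith) hnδ
  have hεpos : 0 < x (p ε) := by linarith
  have hδneg : x (p δ) < 0 := by
    by_contra hcon
    have hδ' : 0 < x (p δ) := lt_of_le_of_ne (not_lt.1 hcon) hnδ.symm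
    have h := htwo.1
    rw [← Equiv.sum_comp p, sum_angleName, if_pos hP, if_pos hδ', if_pos hεpos, hpα, hα,
      if_neg hN.not_gt, if_neg (lt_irrefl _)] at h
    norm_num at h
  have hall : ∀ m, ∃ n n', x (p m) + x (p n) + x (p n') = 0 := by
    intro m
    have h12 := hnm (p m)
    obtain ⟨d, hd⟩ : Nonempty {d // nm d = p m} := Fintype.card_pos_iff.1 (by rw [h12]; norm_num)
    obtain ⟨n, hn⟩ := p.surjective (nm (ρ d))
    obtain ⟨n', hn'⟩ := p.surjective (nm (ρ (ρ d)))
    exact ⟨n, n', by rw [hn, hn', ← hd]; exact hx d⟩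
  have hpα' : x (p α) = 0 := by rw [hpα, hα]
  obtain ⟨a, rfl⟩ := p.surjective N₁
  obtain ⟨b, rfl⟩ := p.surjective N₂
  obtain ⟨c, rfl⟩ := p.surjective P₁
  refine ⟨p, x (p β), hpα, hP, rfl, hγβ, ?_⟩
  have hc : c = β ∨ c = ε := by
    cases c
    · rw [hpα, hα] at hP₁; linarith
    · exact Or.inl rfl
    · linarith
    · linarith
    · exact Or.inr rfl
  have hab : ∀ a, 0 < -x (p a) → a = γ ∨ a = δ := by
    intro a ha
    cases a
    · rw [hpα, hα] at ha; linarith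
    · linarith
    · exact Or.inl rfl
    · exact Or.inr rfl
    · linarith
  rcases hc with rfl | rfl <;> rcases hab a hN₁ with rfl | rfl <;>
    rcases hab b hN₂ with rfl | rfl
  · linarith
  · exact absurd (show x (p ε) = 0 by linarith) hnε
  · exact absurd (show x (p ε) = 0 by linarith) hnε
  · -- The values of `β, γ, δ, ε` are proportional to `2, -4, -1, 3`, so `ε` fits at no vertex.
    obtain ⟨n, n', h⟩ := hall ε
    exfalso
    cases n <;> cases n' <;> linarith
  · -- The values of `β, γ, δ, ε` are proportional to `1, -2, -3, 4`, so `δ` fits at no vertex.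
    obtain ⟨n, n', h⟩ := hall δ
    exfalso
    cases n <;> cases n' <;> linarith
  · linarith
  · linarith
  · constructor <;> linarith

end Classification

/-! ### Arrangements of the angles on the dodecahedron -/

/-- The action on faces of six symmetries of the dodecahedron, three rotations and three reflections.
These suffice to move every solution found by `search` to one of the four patterns. -/
def dodecSymFace : Fin 6 → Fin 12 → Fin 12 :=
  ![![0, 2, 3, 4, 5, 1, 7, 8, 9, 10, 6, 11], ![7, 2, 6, 11, 8, 3, 1, 10, 9, 4, 0, 5],
    ![1, 2, 0, 5, 10, 6, 3, 4, 9, 11, 7, 8], ![0, 1, 5, 4, 3, 2, 10, 9, 8, 7, 6, 11],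
    ![7, 3, 8, 11, 6, 2, 4, 9, 10, 1, 0, 5], ![1, 6, 10, 5, 0, 2, 11, 9, 4, 3, 7, 8]]

/-- The image of the corner `0` of each face under the symmetries of `dodecSymFace`. -/
def dodecSymOffset : Fin 6 → Fin 12 → Fin 5 :=
  ![![1, 0, 0, 0, 0, 0, 0, 0, 0, 0, 0, 4], ![0, 3, 3, 3, 1, 2, 4, 3, 2, 2, 2, 0],
    ![4, 1, 0, 4, 4, 0, 1, 0, 4, 0, 1, 1], ![1, 1, 1, 1, 1, 1, 0, 0, 0, 0, 0, 0],
    ![0, 3, 2, 4, 4, 4, 2, 2, 3, 4, 2, 1], ![4, 1, 0, 0, 1, 2, 0, 4, 0, 1, 1, 2]]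

/-- The action on corners of the symmetries of `dodecSymFace`, the last three of which reverse the
orientation. -/
def dodecSymCorner (s : Fin 6) (i : Fin 12) (k : Fin 5) : Fin 5 :=
  if s < 3 then dodecSymOffset s i + k else dodecSymOffset s i - k

/-- The symmetries of `dodecSymFace` as permutations of the corners of the dodecahedron. -/
def dodecSym (s : Fin 6) (x : Fin 12 × Fin 5) : Fin 12 × Fin 5 :=
  (dodecSymFace s x.1, dodecSymCorner s x.1 x.2)

lemma dodecSymFace_injective : ∀ s, Function.Injective (dodecSymFace s) := by decide +kernel

lemma dodecSym_dodecRot : ∀ s x,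
    (dodecSym s (dodecRot x) = dodecRot (dodecSym s x) ∧
      dodecSym s (dodecRot (dodecRot x)) = dodecRot (dodecRot (dodecSym s x))) ∨
    (dodecSym s (dodecRot x) = dodecRot (dodecRot (dodecSym s x)) ∧
      dodecSym s (dodecRot (dodecRot x)) = dodecRot (dodecSym s x)) := by
  decide +kernel

/-- Numbers for the five angles such that the sum at every vertex is `6`. With `b = false` the
measuring of angles against `2π / 3` is reversed. -/
def angleCode (b : Bool) : AngleName → ℕ
  | .α => 2
  | .β => if b then 3 else 1
  | .γ => if b then 0 else 4
  | .δ => if b then 1 else 3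
  | .ε => if b then 4 else 0

/-- The entry at the corner `k` of a face that carries the cyclic word `w` of length `5`: rotated by
`o` if `o < 5`, and reflected if `5 ≤ o < 10`. -/
def rotatedLabel (w : List ℕ) (o k : ℕ) : ℕ :=
  w.getD (if o < 5 then (k + 5 - o) % 5 else (o - k) % 5) 0

/-- The numbers `F i k` at the corners of the dodecahedron are one of the four patterns up to a
symmetry of the dodecahedron and a change of sign. -/
def IsSymmetricPattern (F : ℕ → ℕ → ℕ) : Prop :=
  ∃ (n : Fin 4) (s : Fin 6) (b : Bool), ∀ (i : Fin 12) (k : Fin 5),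
    F i k = angleCode b (pattern n (dodecSymFace s i) (dodecSymCorner s i k))

instance (F : ℕ → ℕ → ℕ) : Decidable (IsSymmetricPattern F) := by
  unfold IsSymmetricPattern; infer_instance

/-- For each of the faces `1, …, 11` the vertices all of whose other faces come earlier. An entry
`(k, d₁, k₁, d₂, k₂)` for the face `i` stands for the vertex at its corner `k`, which is also the
corner `k₁` of the face `i - d₁` and the corner `k₂` of the face `i - d₂`. -/
def vertexChecks : List (List (ℕ × ℕ × ℕ × ℕ × ℕ)) :=
  [[], [(1, 1, 0, 2, 1)], [(1, 1, 0, 3, 2)], [(1, 1, 0, 4, 3)], [(0, 5, 0, 4, 1), (1, 1, 0, 5, 4)],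
    [(0, 5, 4, 4, 2)], [(0, 5, 4, 4, 2), (1, 1, 4, 5, 3)], [(0, 5, 4, 4, 2), (1, 1, 4, 5, 3)],
    [(0, 5, 4, 4, 2), (1, 1, 4, 5, 3)], [(0, 5, 4, 9, 2), (1, 1, 4, 5, 3), (4, 9, 3, 4, 1)],
    [(0, 1, 3, 5, 2), (1, 2, 3, 1, 2), (2, 3, 3, 2, 2), (3, 4, 3, 3, 2), (4, 5, 3, 4, 2)]]

/-- The sum at the vertex `c` is `6`. The list `l` contains the positions of the word `w` on the
faces treated so far, the latest one first. -/
def vertexCheck (w : List ℕ) (l : List ℕ) (c : ℕ × ℕ × ℕ × ℕ × ℕ) : Bool :=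
  Nat.beq (rotatedLabel w (l.getD 0 0) c.1 + rotatedLabel w (l.getD c.2.1 0) c.2.2.1 +
    rotatedLabel w (l.getD c.2.2.2.1 0) c.2.2.2.2) 6

/-- Backtracking over the positions of the word `w` on the remaining faces. The result is `true` if
all solutions are symmetric to one of the patterns. -/
def search (w : List ℕ) : List (List (ℕ × ℕ × ℕ × ℕ × ℕ)) → List ℕ → Bool
  | [], l => decide (IsSymmetricPattern fun i k => rotatedLabel w (l.getD (11 - i) 0) k)
  | c :: cs, l => [0, 1, 2, 3, 4, 5, 6, 7, 8, 9].all fun o =>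
      !(c.all (vertexCheck w (o :: l))) || search w cs (o :: l)

/-- The exhaustive search; it visits about 26000 positions and finds 24 solutions. -/
lemma search_eq_true : ∀ a ∈ [0, 1, 3, 4], ∀ b ∈ [0, 1, 3, 4], ∀ c ∈ [0, 1, 3, 4],
    ∀ d ∈ [0, 1, 3, 4], [2, a, b, c, d].Nodup → search [2, a, b, c, d] vertexChecks [0] = true := by
  decide +kernel

/-- The list `[o (i - 1), …, o 0]`. -/
def prefixList (o : ℕ → ℕ) : ℕ → List ℕ
  | 0 => []
  | i + 1 => o i :: prefixList o i

lemma prefixList_getD (o : ℕ → ℕ) : ∀ i j, j ≤ i → (prefixList o (i + 1)).getD j 0 = o (i - j)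
  | _, 0, _ => rfl
  | i + 1, j + 1, h => by
    rw [Nat.add_sub_add_right]
    exact prefixList_getD o i j (by omega)

/-- Soundness of the search. -/
lemma isSymmetricPattern_of_search (w : List ℕ) (o : ℕ → ℕ) (ho : ∀ i, o i < 10) :
    ∀ (cs : List (List (ℕ × ℕ × ℕ × ℕ × ℕ))) (i : ℕ), i + cs.length = 12 →
      search w cs (prefixList o i) = true →
      (∀ j (hj : j < cs.length), ∀ c ∈ cs[j], vertexCheck w (prefixList o (i + j + 1)) c = true) →
      IsSymmetricPattern fun i k => rotatedLabel w (o i) k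
  | [], i, hi, hs, _ => by
    have hs' := of_decide_eq_true hs
    obtain ⟨n, s, b, h⟩ := hs'
    refine ⟨n, s, b, fun f k => ?_⟩
    have hi' : i = 11 + 1 := hi
    have h1 := h f k
    beta_reduce at h1
    rw [hi', prefixList_getD o 11 (11 - f) (by omega), Nat.sub_sub_self (by omega)] at h1
    exact h1
  | c :: cs, i, hi, hs, hc => by
    have h1 := List.all_eq_true.1 hs (o i) (by
      have := ho i
      simp only [List.mem_cons, List.not_mem_nil, or_false]
      omega)
    have h2 : c.all (vertexCheck w (o i :: prefixList o i)) = true :=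
      List.all_eq_true.2 fun x hx => hc 0 (by simp) x hx
    rw [h2] at h1
    refine isSymmetricPattern_of_search w o ho cs (i + 1)
      (by rw [← hi, List.length_cons]; omega) (by simpa [prefixList] using h1) fun j hj x hx => ?_
    have := hc (j + 1) (by simpa using hj) x (by simpa using hx)
    rwa [show i + (j + 1) + 1 = i + 1 + j + 1 by omega] at this

theorem isSymmetricPattern_of_vertex_sums {a b c d : ℕ} (ha : a ∈ [0, 1, 3, 4])
    (hb : b ∈ [0, 1, 3, 4]) (hc : c ∈ [0, 1, 3, 4]) (hd : d ∈ [0, 1, 3, 4])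
    (hnd : [2, a, b, c, d].Nodup) (o : ℕ → ℕ) (ho : ∀ i, o i < 10) (ho0 : o 0 = 0)
    (hv : ∀ x : Fin 12 × Fin 5, rotatedLabel [2, a, b, c, d] (o x.1) x.2 +
      rotatedLabel [2, a, b, c, d] (o (dodecRot x).1) (dodecRot x).2 +
      rotatedLabel [2, a, b, c, d] (o (dodecRot (dodecRot x)).1) (dodecRot (dodecRot x)).2 = 6) :
    IsSymmetricPattern fun i k => rotatedLabel [2, a, b, c, d] (o i) k := by
  have hs := search_eq_true a ha b hb c hc d hd hnd
  refine isSymmetricPattern_of_search _ o ho vertexChecks 1 rfl (by simpa [prefixList, ho0] using hs) ?_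
  generalize [2, a, b, c, d] = w at hv
  have key : ∀ (i : ℕ) (e : ℕ × ℕ × ℕ × ℕ × ℕ), e.2.1 ≤ i → e.2.2.2.1 ≤ i →
      rotatedLabel w (o i) e.1 + rotatedLabel w (o (i - e.2.1)) e.2.2.1 +
        rotatedLabel w (o (i - e.2.2.2.1)) e.2.2.2.2 = 6 →
      vertexCheck w (prefixList o (i + 1)) e = true := by
    intro i e h1 h2 h
    rw [vertexCheck, prefixList_getD o i 0 (Nat.zero_le _), prefixList_getD o i _ h1,
      prefixList_getD o i _ h2, Nat.sub_zero, h]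
    rfl
  have hchk : ∀ j : Fin 11, ∀ e ∈ vertexChecks[j]'j.2, e.2.1 ≤ 1 + (j : ℕ) ∧ e.2.2.2.1 ≤ 1 + (j : ℕ) ∧
      ∃ x : Fin 12 × Fin 5, (x.1 : ℕ) = 1 + j ∧ (x.2 : ℕ) = e.1 ∧
        ((dodecRot x).1 : ℕ) = 1 + j - e.2.1 ∧ ((dodecRot x).2 : ℕ) = e.2.2.1 ∧
        ((dodecRot (dodecRot x)).1 : ℕ) = 1 + j - e.2.2.2.1 ∧
        ((dodecRot (dodecRot x)).2 : ℕ) = e.2.2.2.2 := by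
    decide +kernel
  intro j hj e he
  obtain ⟨h1, h2, x, e1, e2, e3, e4, e5, e6⟩ := hchk ⟨j, hj⟩ e he
  refine key _ e h1 h2 ?_
  have := hv x
  rw [e1, e2, e3, e4, e5, e6] at this
  exact this

/-! ### Vertices of the dodecahedron and cyclic words of angles -/

lemma dodecSym_injective (s : Fin 6) : Function.Injective (dodecSym s) := by
  rintro ⟨i, k⟩ ⟨j, l⟩ h
  have h1 : dodecSymFace s i = dodecSymFace s j := congrArg Prod.fst h
  have h2 : dodecSymCorner s i k = dodecSymCorner s j l := congrArg Prod.snd h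
  obtain rfl := dodecSymFace_injective s h1
  refine Prod.ext rfl ?_
  unfold dodecSymCorner at h2
  split_ifs at h2
  · exact add_left_cancel h2
  · exact sub_right_injective h2

lemma dodecVertex_eq_iff : ∀ x y : Fin 12 × Fin 5, dodecVertex x.1 x.2 = dodecVertex y.1 y.2 ↔
    y = x ∨ y = dodecRot x ∨ y = dodecRot (dodecRot x) := by
  decide +kernel

lemma dodecVertex_dodecSym_eq_iff (s : Fin 6) (x y : Fin 12 × Fin 5) :
    dodecVertex (dodecSym s x).1 (dodecSym s x).2 = dodecVertex (dodecSym s y).1 (dodecSym s y).2 ↔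
    y = x ∨ y = dodecRot x ∨ y = dodecRot (dodecRot x) := by
  rw [dodecVertex_eq_iff]
  rcases dodecSym_dodecRot s x with ⟨h1, h2⟩ | ⟨h1, h2⟩
  · rw [← h2, ← h1, (dodecSym_injective s).eq_iff, (dodecSym_injective s).eq_iff,
      (dodecSym_injective s).eq_iff]
  · rw [← h1, ← h2, (dodecSym_injective s).eq_iff, (dodecSym_injective s).eq_iff,
      (dodecSym_injective s).eq_iff, or_comm (a := y = dodecRot (dodecRot x))]

/-- One corner at each of the `20` vertices of the dodecahedron: the one of the face with the
smallest number. -/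
def dodecVertexReps : Finset (Fin 12 × Fin 5) :=
  Finset.univ.filter fun x => x.1 < (dodecRot x).1 ∧ x.1 < (dodecRot (dodecRot x)).1

lemma exists_mem_dodecVertexReps : ∀ x, x ∈ dodecVertexReps ∨ dodecRot x ∈ dodecVertexReps ∨
    dodecRot (dodecRot x) ∈ dodecVertexReps := by
  decide +kernel

lemma eq_of_mem_dodecVertexReps {x y : Fin 12 × Fin 5} (hx : x ∈ dodecVertexReps)
    (hy : y ∈ dodecVertexReps) (h : y = x ∨ y = dodecRot x ∨ y = dodecRot (dodecRot x)) : x = y := by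
  simp only [dodecVertexReps, Finset.mem_filter, Finset.mem_univ, true_and] at hx hy
  rcases h with h | h | h
  · exact h.symm
  · subst h
    rw [dodecRot_rot_rot] at hy
    exact absurd (hx.1.trans hy.2) (lt_irrefl _)
  · subst h
    rw [dodecRot_rot_rot] at hy
    exact absurd (hx.2.trans hy.1) (lt_irrefl _)

/-- The angle at a corner in the pattern `n`. -/
def patternName (n : Fin 4) (x : Fin 12 × Fin 5) : AngleName := pattern n x.1 x.2

lemma pattern_vertexCombination : ∀ (n : Fin 4) (s : Fin 6),
    dodecVertexReps.val.map (fun x => ({patternName n (dodecSym s x),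
      patternName n (dodecSym s (dodecRot x)),
      patternName n (dodecSym s (dodecRot (dodecRot x)))} : Multiset AngleName)) =
    Multiset.replicate 2 {α, α, α} + Multiset.replicate 6 {α, γ, ε} +
      Multiset.replicate 6 {β, β, γ} + Multiset.replicate 6 {δ, δ, ε} := by
  decide +kernel

lemma exists_rotation_or_reflection (f : Fin 5 → Fin 5) (hf : Function.Injective f)
    (h : ∀ k, f (k + 1) = f k + 1 ∨ f k = f (k + 1) + 1) :
    (∀ k, f k = f 0 + k) ∨ (∀ k, f k = f 0 - k) := by
  have step : ∀ a b c : Fin 5, (b = a + 1 ∨ a = b + 1) → (c = b + 1 ∨ b = c + 1) → a ≠ c →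
      (b = a + 1 → c = b + 1) ∧ (b = a - 1 → c = b - 1) := by decide +kernel
  have hne : ∀ k, f k ≠ f (k + 1 + 1) := fun k => hf.ne (by revert k; decide)
  have hs := fun k => step (f k) (f (k + 1)) (f (k + 1 + 1)) (h k) (h (k + 1)) (hne k)
  rcases h 0 with h1 | h1
  · left
    replace h1 : f 1 = f 0 + 1 := h1
    have h2 : f 2 = f 1 + 1 := (hs 0).1 h1
    have h3 : f 3 = f 2 + 1 := (hs 1).1 h2
    have h4 : f 4 = f 3 + 1 := (hs 2).1 h3
    rw [h3, h2, h1] at h4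
    rw [h2, h1] at h3
    rw [h1] at h2
    intro k
    fin_cases k
    · exact (add_zero _).symm
    · exact h1
    · exact h2.trans (by rw [add_assoc]; rfl)
    · exact h3.trans (by rw [add_assoc, add_assoc]; rfl)
    · exact h4.trans (by rw [add_assoc, add_assoc, add_assoc]; rfl)
  · right
    rw [eq_comm, ← eq_sub_iff_add_eq] at h1
    replace h1 : f 1 = f 0 - 1 := h1
    have h2 : f 2 = f 1 - 1 := (hs 0).2 h1
    have h3 : f 3 = f 2 - 1 := (hs 1).2 h2
    have h4 : f 4 = f 3 - 1 := (hs 2).2 h3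
    rw [h3, h2, h1] at h4
    rw [h2, h1] at h3
    rw [h1] at h2
    intro k
    fin_cases k
    · exact (sub_zero _).symm
    · exact h1
    · exact h2.trans (by rw [sub_sub]; rfl)
    · exact h3.trans (by rw [sub_sub, sub_sub]; rfl)
    · exact h4.trans (by rw [sub_sub, sub_sub, sub_sub]; rfl)

namespace PentagonTiling

variable {ι : Type*} [Fintype ι] (T : PentagonTiling ι)

lemma AngleCongruent.exists_rotation_or_reflection {T : PentagonTiling ι} {i j : ι}
    (h : T.AngleCongruent i j) : ∃ c : Fin 5,
      (∀ k, T.angle j k = T.angle i (k - c)) ∨ (∀ k, T.angle j k = T.angle i (c - k)) := by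
  obtain ⟨f, hf⟩ := h
  have hm : ∀ k, T.SidesMeet j (f k) (f (k + 1)) (T.angle i (k + 1)) := fun k =>
    (hf k (k + 1) _).1 (Or.inl ⟨rfl, rfl⟩)
  have hadd : ∀ u : Fin 5, u + 1 ≠ u := by decide
  have hne2 : ∀ u : Fin 5, u ≠ u + 1 + 1 := by decide
  rcases SphTiling.exists_rotation_or_reflection f f.injective
    (fun k => (hm k).imp And.left And.left) with h | h
  · refine ⟨f 0, Or.inl fun k => ?_⟩
    have h1 : f (k - f 0 - 1 + 1) = f (k - f 0 - 1) + 1 := by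
      rw [h (k - f 0 - 1 + 1), h (k - f 0 - 1)]; abel
    have h2 : f (k - f 0 - 1 + 1) = k := by rw [h]; abel
    rcases hm (k - f 0 - 1) with ⟨-, h3⟩ | ⟨h3, -⟩
    · rw [h2] at h3
      rw [← h3, sub_add_cancel]
    · rw [h1] at h3
      exact absurd h3 (hne2 _)
  · refine ⟨f 0 + 1, Or.inr fun k => ?_⟩
    have h1 : f (f 0 - k) = f (f 0 - k + 1) + 1 := by
      rw [h (f 0 - k + 1), h (f 0 - k)]; abel
    have h2 : f (f 0 - k) = k := by rw [h]; abel
    rcases hm (f 0 - k) with ⟨h3, -⟩ | ⟨-, h3⟩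
    · rw [h3] at h1
      exact absurd h1 (hne2 _)
    · rw [h2] at h3
      rw [← h3]
      congr 1
      abel

lemma anglewiseVertexCombination_eq (hcard : Fintype.card ι = 12)
    (Φ : Fin 12 × Fin 5 ≃ ι × Fin 5) (hΦ : ∀ x, T.rot (Φ x) = Φ (dodecRot x)) :
    T.anglewiseVertexCombination = dodecVertexReps.val.map fun x =>
      ({T.angle (Φ x).1 (Φ x).2, T.angle (Φ (dodecRot x)).1 (Φ (dodecRot x)).2,
        T.angle (Φ (dodecRot (dodecRot x))).1 (Φ (dodecRot (dodecRot x))).2} : Multiset ℝ) := by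
  classical
  have hvtx : ∀ x y, T.vtx (Φ x) = T.vtx (Φ y) ↔
      y = x ∨ y = dodecRot x ∨ y = dodecRot (dodecRot x) := fun x y => by
    rw [T.vtx_eq_iff hcard, hΦ, hΦ, Φ.injective.eq_iff, Φ.injective.eq_iff, Φ.injective.eq_iff]
  have hV : T.vertices = dodecVertexReps.image fun x => T.vtx (Φ x) := by
    ext v
    simp only [vertices, Finset.mem_image, Finset.mem_univ, true_and]
    constructor
    · rintro ⟨q, rfl⟩
      obtain ⟨x, rfl⟩ := Φ.surjective q
      rcases exists_mem_dodecVertexReps x with h | h | h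
      · exact ⟨_, h, rfl⟩
      · exact ⟨_, h, ((hvtx _ _).2 (Or.inr (Or.inl rfl))).symm⟩
      · exact ⟨_, h, ((hvtx _ _).2 (Or.inr (Or.inr rfl))).symm⟩
    · rintro ⟨x, -, rfl⟩
      exact ⟨_, rfl⟩
  rw [anglewiseVertexCombination, hV, Finset.image_val_of_injOn fun x hx y hy h =>
    eq_of_mem_dodecVertexReps hx hy ((hvtx x y).1 h), Multiset.map_map]
  refine Multiset.map_congr rfl fun x _ => ?_
  have h := T.dartsAt_vtx hcard (Φ x)
  have h1 : T.vertexAngles (T.vtx (Φ x)) =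
      (T.dartsAt (T.vtx (Φ x))).val.map fun q => T.angle q.1 q.2 := by
    unfold vertexAngles dartsAt vtx
    rfl
  rw [Function.comp_apply, h1, h, Finset.insert_val_of_notMem, Finset.insert_val_of_notMem,
    Finset.singleton_val, hΦ, hΦ]
  · rfl
  · simpa using (T.rot_ne _).symm
  · simpa using ⟨(T.rot_ne _).symm, (T.rot_rot_ne hcard _).symm⟩

end PentagonTiling

/-! ### Assembling the arrangement -/

/-- The excess of the angles over `2π / 3`, in units of the excess of `β`. -/
def angleOffset : AngleName → ℤ
  | .α => 0
  | .β => 1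
  | .γ => -2
  | .δ => -1
  | .ε => 2

lemma angleCode_true : ∀ n, (angleCode true n : ℤ) = angleOffset n + 2 := by decide

lemma angleCode_true_injective : Function.Injective (angleCode true) := by decide

/-- The exchange of names that reverses the sign of the excess. -/
def negName : Equiv.Perm AngleName := (Equiv.swap β δ).trans (Equiv.swap γ ε)

lemma angleCode_false : ∀ n, angleCode false n = angleCode true (negName n) := by decide

lemma angleCode_true_mem : ∀ n, n ≠ α → angleCode true n ∈ [0, 1, 3, 4] := by decide

lemma rotatedLabel_rotation (w : Fin 5 → ℕ) (c k : Fin 5) :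
    rotatedLabel [w 0, w 1, w 2, w 3, w 4] c k = w (k - c) := by
  have h : ∀ c k : Fin 5, (c : ℕ) < 5 ∧ ((k : ℕ) + 5 - c) % 5 = (k - c : Fin 5) := by decide
  rw [rotatedLabel, if_pos (h c k).1, (h c k).2]
  generalize k - c = j
  fin_cases j <;> rfl

lemma rotatedLabel_reflection (w : Fin 5 → ℕ) (c k : Fin 5) :
    rotatedLabel [w 0, w 1, w 2, w 3, w 4] (5 + c) k = w (c - k) := by
  have h : ∀ c k : Fin 5, ¬ (5 + (c : ℕ) < 5) ∧ (5 + (c : ℕ) - k) % 5 = (c - k : Fin 5) := by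
    decide
  rw [rotatedLabel, if_neg (h c k).1, (h c k).2]
  generalize c - k = j
  fin_cases j <;> rfl

namespace PentagonTiling

variable {ι : Type*} [Fintype ι] (T : PentagonTiling ι)

lemma exists_angleName {a : AngleName → ℝ} (ha : Function.Injective a)
    (hangles : ∀ i, T.tileAngles i = (Finset.univ : Finset AngleName).val.map a) :
    ∃ nm : ι × Fin 5 → AngleName, (∀ d, T.angle d.1 d.2 = a (nm d)) ∧
      ∀ i, Function.Bijective fun k => nm (i, k) := by
  have h : ∀ d : ι × Fin 5, ∃ n, T.angle d.1 d.2 = a n := by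
    intro d
    have hd : T.angle d.1 d.2 ∈ T.tileAngles d.1 :=
      Multiset.mem_map_of_mem _ (Finset.mem_univ_val d.2)
    rw [hangles] at hd
    obtain ⟨n, -, hn⟩ := Multiset.mem_map.1 hd
    exact ⟨n, hn.symm⟩
  choose nm hnm using h
  refine ⟨nm, hnm, fun i => (Fintype.bijective_iff_injective_and_card _).2 ⟨?_, rfl⟩⟩
  intro k l hkl
  have hnd : (T.tileAngles i).Nodup := by
    rw [hangles]
    exact Finset.univ.nodup.map ha
  refine Multiset.inj_on_of_nodup_map hnd k (Finset.mem_univ_val k) l (Finset.mem_univ_val l) ?_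
  have h1 := hnm (i, k)
  have h2 := hnm (i, l)
  simp only at hkl h1 h2
  rw [h1, h2, hkl]

lemma card_name_eq {nm : ι × Fin 5 → AngleName}
    (hb : ∀ i, Function.Bijective fun k => nm (i, k)) (n : AngleName)
    [Fintype {d // nm d = n}] : Fintype.card {d // nm d = n} = Fintype.card ι := by
  refine Fintype.card_of_bijective (f := fun d => d.1.1) ⟨?_, ?_⟩
  · rintro ⟨⟨i, k⟩, hk⟩ ⟨⟨j, l⟩, hl⟩ hij
    obtain rfl : i = j := hij
    obtain rfl : k = l := (hb i).1 (hk.trans hl.symm)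
    rfl
  · intro i
    obtain ⟨k, hk⟩ := (hb i).2 n
    exact ⟨⟨(i, k), hk⟩, rfl⟩

/-- The five angles can be named so that in terms of `angleCode` the sum at every vertex is `6`. -/
lemma exists_normalized_names (hcard : Fintype.card ι = 12)
    {a : AngleName → ℝ} (ha : Function.Injective a) (hα : a α = 2 * Real.pi / 3)
    (hangles : ∀ i, T.tileAngles i = (Finset.univ : Finset AngleName).val.map a) :
    ∃ (p : Equiv.Perm AngleName) (q : ι × Fin 5 → AngleName), p α = α ∧
      (∀ d, T.angle d.1 d.2 = a (p (q d))) ∧ (∀ i, Function.Bijective fun k => q (i, k)) ∧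
      ∀ d, angleCode true (q d) + angleCode true (q (T.rot d)) +
        angleCode true (q (T.rot (T.rot d))) = 6 := by
  classical
  obtain ⟨nm, hnm, hb⟩ := T.exists_angleName ha hangles
  have hsum : ∀ d, (a (nm d) - 2 * Real.pi / 3) + (a (nm (T.rot d)) - 2 * Real.pi / 3) +
      (a (nm (T.rot (T.rot d))) - 2 * Real.pi / 3) = 0 := by
    intro d
    have h := T.sum_angle_rot hcard d
    rw [hnm d, hnm (T.rot d), hnm (T.rot (T.rot d))] at h
    linarith
  obtain ⟨p, t, hp, ht, hβ, hγ, hδ, hε⟩ := angle_classification (x := fun n => a n - 2 * Real.pi / 3)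
    T.rot_injective (fun n => (card_name_eq hb n).trans hcard)
    (fun m n h => ha (sub_left_injective h)) (by rw [hα, sub_self]) hsum
  have hval : ∀ n, a (p n) - 2 * Real.pi / 3 = angleOffset n * t := by
    intro n
    cases n
    · simp [angleOffset, hp, hα]
    · simp only [angleOffset]; push_cast; linarith
    · simp only [angleOffset]; push_cast; linarith
    · simp only [angleOffset]; push_cast; linarith
    · simp only [angleOffset]; push_cast; linarith
  refine ⟨p, fun d => p.symm (nm d), hp, fun d => ?_, fun i => ?_, fun d => ?_⟩
  · rw [Equiv.apply_symm_apply, hnm]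
  · exact p.symm.bijective.comp (hb i)
  · have h := hsum d
    have hv : ∀ d, a (nm d) - 2 * Real.pi / 3 = angleOffset (p.symm (nm d)) * t := fun d => by
      rw [← hval, Equiv.apply_symm_apply]
    rw [hv, hv, hv, ← add_mul, ← add_mul] at h
    have h0 := (mul_eq_zero.1 h).resolve_right ht.ne'
    have h1 : angleOffset (p.symm (nm d)) + angleOffset (p.symm (nm (T.rot d))) +
        angleOffset (p.symm (nm (T.rot (T.rot d)))) = 0 := by exact_mod_cast h0
    have e1 := angleCode_true (p.symm (nm d))
    have e2 := angleCode_true (p.symm (nm (T.rot d)))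
    have e3 := angleCode_true (p.symm (nm (T.rot (T.rot d))))
    beta_reduce
    omega

/-- Angle congruent tiles carry the same cyclic word of angles up to rotation and reflection, read
from any corners `m` and `n`. -/
lemma exists_rotatedLabel {a : AngleName → ℝ} (ha : Function.Injective a)
    {p : Equiv.Perm AngleName} {q : ι × Fin 5 → AngleName}
    (hq : ∀ d, T.angle d.1 d.2 = a (p (q d))) {i j : ι} (h : T.AngleCongruent i j) (m n : Fin 5) :
    ∃ o < 10, ∀ k : Fin 5, angleCode true (q (j, n + k)) =
      rotatedLabel [angleCode true (q (i, m + 0)), angleCode true (q (i, m + 1)),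
        angleCode true (q (i, m + 2)), angleCode true (q (i, m + 3)),
        angleCode true (q (i, m + 4))] o k := by
  have hang : ∀ u v, T.angle j u = T.angle i v → q (j, u) = q (i, v) := by
    intro u v huv
    have h1 := hq (j, u)
    have h2 := hq (i, v)
    simp only at h1 h2
    rw [h1, h2] at huv
    exact p.injective (ha huv)
  obtain ⟨c, hc | hc⟩ := h.exists_rotation_or_reflection
  · refine ⟨(m + c - n : Fin 5), by omega, fun k => ?_⟩
    rw [rotatedLabel_rotation (fun k => angleCode true (q (i, m + k))), hang _ _ (hc (n + k))]
    congr 3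
    abel
  · refine ⟨5 + (c - m - n : Fin 5), by omega, fun k => ?_⟩
    rw [rotatedLabel_reflection (fun k => angleCode true (q (i, m + k))), hang _ _ (hc (n + k))]
    congr 3
    abel

/-- Up to names and symmetries of the dodecahedron, the angles form one of the four patterns. -/
theorem exists_pattern (hcard : Fintype.card ι = 12) (hcongr : ∀ i j, T.AngleCongruent i j)
    {a : AngleName → ℝ} (ha : Function.Injective a) (hα : a α = 2 * Real.pi / 3)
    (hangles : ∀ i, T.tileAngles i = (Finset.univ : Finset AngleName).val.map a) :
    ∃ (p : Equiv.Perm AngleName) (n : Fin 4) (s : Fin 6) (τ : Fin 12 ≃ ι) (o : Fin 12 → Fin 5),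
      p α = α ∧
      (∀ x : Fin 12 × Fin 5, T.rot (τ x.1, o x.1 + x.2) =
        (τ (dodecRot x).1, o (dodecRot x).1 + (dodecRot x).2)) ∧
      ∀ x : Fin 12 × Fin 5, T.angle (τ x.1) (o x.1 + x.2) = a (p (patternName n (dodecSym s x))) := by
  obtain ⟨p, q, hp, hq, hb, hsum⟩ := T.exists_normalized_names hcard ha hα hangles
  obtain ⟨i₀⟩ : Nonempty ι := Fintype.card_pos_iff.1 (by rw [hcard]; norm_num)
  obtain ⟨k₀, hk₀⟩ := (hb i₀).2 α
  obtain ⟨τ, o, hτ, ho, hrot⟩ := T.exists_dodecahedral_labelling hcard (i₀, k₀)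
  have hopt : ∀ i : ℕ, ∃ r < 10, (i = 0 → r = 0) ∧ ∀ (hi : i < 12) (k : Fin 5),
      angleCode true (q (τ ⟨i, hi⟩, o ⟨i, hi⟩ + k)) =
        rotatedLabel [angleCode true (q (τ 0, o 0 + 0)), angleCode true (q (τ 0, o 0 + 1)),
          angleCode true (q (τ 0, o 0 + 2)), angleCode true (q (τ 0, o 0 + 3)),
          angleCode true (q (τ 0, o 0 + 4))] r k := by
    intro i
    rcases Nat.eq_zero_or_pos i with rfl | hpos
    · refine ⟨0, by norm_num, fun _ => rfl, fun hi k => ?_⟩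
      have h := rotatedLabel_rotation (fun k => angleCode true (q (τ 0, o 0 + k))) 0 k
      rw [sub_zero] at h
      exact h.symm
    · by_cases hi : i < 12
      · obtain ⟨r, hr, hrk⟩ := T.exists_rotatedLabel ha hq (hcongr (τ 0) (τ ⟨i, hi⟩)) (o 0) (o ⟨i, hi⟩)
        exact ⟨r, hr, fun h => absurd h hpos.ne', fun _ => hrk⟩
      · exact ⟨0, by norm_num, fun _ => rfl, fun h => absurd h hi⟩
  choose r hr hr0 hrk using hopt
  have hF : ∀ x : Fin 12 × Fin 5, angleCode true (q (τ x.1, o x.1 + x.2)) = _ := fun x =>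
    hrk x.1 x.1.2 x.2
  have h0 : q (τ 0, o 0 + 0) = α := by rw [hτ, ho, add_zero]; exact hk₀
  have hinj : ∀ k l : Fin 5, q (τ 0, o 0 + k) = q (τ 0, o 0 + l) → k = l := fun k l h =>
    add_left_cancel ((hb (τ 0)).1 h)
  have hmem : ∀ k : Fin 5, k ≠ 0 → angleCode true (q (τ 0, o 0 + k)) ∈ [0, 1, 3, 4] := fun k hk =>
    angleCode_true_mem _ fun h => hk (hinj _ _ (h.trans h0.symm))
  have hnd : [angleCode true (q (τ 0, o 0 + 0)), angleCode true (q (τ 0, o 0 + 1)),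
      angleCode true (q (τ 0, o 0 + 2)), angleCode true (q (τ 0, o 0 + 3)),
      angleCode true (q (τ 0, o 0 + 4))].Nodup := by
    have : (([0, 1, 2, 3, 4] : List (Fin 5)).map fun k => angleCode true (q (τ 0, o 0 + k))).Nodup :=
      List.Nodup.map (fun k l h => hinj k l (angleCode_true_injective h)) (by decide)
    exact this
  have hcode0 : angleCode true (q (τ 0, o 0 + 0)) = 2 := by rw [h0]; rfl
  rw [hcode0] at hnd hF
  obtain ⟨n, s, b, hpat⟩ := isSymmetricPattern_of_vertex_sums (hmem 1 (by decide))
    (hmem 2 (by decide)) (hmem 3 (by decide)) (hmem 4 (by decide)) hnd r hr (hr0 0 rfl) (fun x => by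
      rw [← hF, ← hF, ← hF, ← hrot (dodecRot x), ← hrot x]
      exact hsum _)
  have hpat' : ∀ x : Fin 12 × Fin 5, angleCode true (q (τ x.1, o x.1 + x.2)) =
      angleCode b (patternName n (dodecSym s x)) := fun x => (hF x).trans (hpat x.1 x.2)
  cases b
  · refine ⟨negName.trans p, n, s, τ, o, ?_, hrot, fun x => ?_⟩
    · rw [Equiv.trans_apply, show negName α = α by decide, hp]
    · have h1 := hpat' x
      rw [angleCode_false] at h1
      have h2 := hq (τ x.1, o x.1 + x.2)
      simp only at h2
      rw [h2, angleCode_true_injective h1, Equiv.trans_apply]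
  · refine ⟨p, n, s, τ, o, hp, hrot, fun x => ?_⟩
    have h2 := hq (τ x.1, o x.1 + x.2)
    simp only at h2
    rw [h2, angleCode_true_injective (hpat' x)]

/-- The correspondence of corners given by a correspondence `τ` of faces and tiles and offsets `o`. -/
def dartEquiv (τ : Fin 12 ≃ ι) (o : Fin 12 → Fin 5) : Fin 12 × Fin 5 ≃ ι × Fin 5 where
  toFun x := (τ x.1, o x.1 + x.2)
  invFun d := (τ.symm d.1, d.2 - o (τ.symm d.1))
  left_inv x := by simp
  right_inv d := by simp

lemma isGivenBy_of_labelling (hcard : Fintype.card ι = 12) {n : Fin 4} {s : Fin 6}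
    {τ : Fin 12 ≃ ι} {o : Fin 12 → Fin 5} {c : AngleName → ℝ}
    (hrot : ∀ x, T.rot (dartEquiv τ o x) = dartEquiv τ o (dodecRot x))
    (hang : ∀ x, T.angle (dartEquiv τ o x).1 (dartEquiv τ o x).2 = c (patternName n (dodecSym s x))) :
    T.IsGivenBy (pattern n) c := by
  have hface : Function.Bijective (dodecSymFace s) :=
    Finite.injective_iff_bijective.1 (dodecSymFace_injective s)
  have hcorner : ∀ i, Function.Bijective (fun k => dodecSymCorner s i (k - o i)) := by
    intro i
    refine Finite.injective_iff_bijective.1 fun k l h => ?_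
    have := dodecSym_injective s (a₁ := (i, k - o i)) (a₂ := (i, l - o i)) (Prod.ext rfl h)
    exact sub_left_injective (congrArg Prod.snd this)
  refine ⟨τ.symm.trans (Equiv.ofBijective _ hface),
    fun i => Equiv.ofBijective _ (hcorner (τ.symm i)), fun i k => ?_, fun i k j l => ?_,
    fun i k => ?_⟩
  · simp only [Equiv.ofBijective_apply, dodecSymCorner]
    split_ifs
    · left; abel
    · right; abel
  · set x := (dartEquiv τ o).symm (i, k) with hx
    set y := (dartEquiv τ o).symm (j, l) with hy
    have hx' : (i, k) = dartEquiv τ o x := by rw [hx, Equiv.apply_symm_apply]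
    have hy' : (j, l) = dartEquiv τ o y := by rw [hy, Equiv.apply_symm_apply]
    refine Iff.trans ?_ (dodecVertex_dodecSym_eq_iff s x y).symm
    change T.vtx (i, k) = T.vtx (j, l) ↔ _
    rw [hx', hy', T.vtx_eq_iff hcard, hrot, hrot, (dartEquiv τ o).injective.eq_iff,
      (dartEquiv τ o).injective.eq_iff, (dartEquiv τ o).injective.eq_iff]
  · have h := hang ((dartEquiv τ o).symm (i, k))
    rw [Equiv.apply_symm_apply] at h
    exact h

end PentagonTiling

end SphTiling
end

open SphTiling SphTiling.AngleName in
theorem proposition20 {ι : Type*} [Fintype ι] (hcard : Fintype.card ι = 12)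
    (T : PentagonTiling ι)
    (hcongr : ∀ i j, T.AngleCongruent i j)
    (a : AngleName → ℝ) (ha : Function.Injective a) (hα : a α = 2 * Real.pi / 3)
    (hangles : ∀ i, T.tileAngles i = (Finset.univ : Finset AngleName).val.map a) :
    ∃ p : Equiv.Perm AngleName, p α = α ∧
      T.anglewiseVertexCombination =
        Multiset.replicate 2 {a (p α), a (p α), a (p α)} +
        Multiset.replicate 6 {a (p α), a (p γ), a (p ε)} +
        Multiset.replicate 6 {a (p β), a (p β), a (p γ)} +
        Multiset.replicate 6 {a (p δ), a (p δ), a (p ε)} ∧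
      ∃ n : Fin 4, T.IsGivenBy (pattern n) (a ∘ p) := by
  obtain ⟨p, n, s, τ, o, hp, hrot, hang⟩ := T.exists_pattern hcard hcongr ha hα hangles
  refine ⟨p, hp, ?_, n, T.isGivenBy_of_labelling hcard (τ := τ) (o := o) (s := s) hrot hang⟩
  have h := congrArg (Multiset.map (Multiset.map (a ∘ p))) (pattern_vertexCombination n s)
  rw [T.anglewiseVertexCombination_eq hcard (PentagonTiling.dartEquiv τ o) hrot]
  simp only [Multiset.map_add, Multiset.map_replicate, Multiset.map_map, Multiset.insert_eq_cons,
    Multiset.map_cons, Multiset.map_singleton, Function.comp_apply] at h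
  simp only [Multiset.insert_eq_cons]
  rw [← h]
  refine Multiset.map_congr rfl fun x _ => ?_
  have e : ∀ x, T.angle (PentagonTiling.dartEquiv τ o x).1 (PentagonTiling.dartEquiv τ o x).2 =
      a (p (patternName n (dodecSym s x))) := hang
  rw [e, e, e]
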